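/- Let $\mathbf{k}$ be a field and $V$ a $\mathbf{k}$-vector space with basis $\Omega$. **Conventions.** A dendriform trialgebra is a vector space with bilinear operations $\prec,\succ,\cdot$ satisfying, with $\star=\prec+\succ+\cdot$, $(x\prec y)\prec z=x\prec(y\star z)$, $(x\succ y)\prec z=x\succ(y\prec z)$, $(x\star y)\succ z=x\succ(y\succ z)$, $(x\succ y)\cdot z=x\succ(y\cdot z)$, $(x\prec y)\cdot z=x\cdot(y\succ z)$, $(x\cdot y)\prec z=x\cdot(y\prec z)$, $(x\cdot y)\cdot z=x\cdot(y\cdot z)$. A nonunitary Rota-Baxter algebra of weight $\lambda$ is a nonunitary associative $\mathbf{k}$-algebra $A$ with a linear operator $R$ such that $R(x)R(y)=R(R(x)y+xR(y)+\lambda xy)$; it carries the operations $x\prec_R y=xR(y)$, $x\succ_R y=R(x)y$, $x\cdot_R y=\lambda xy$. *Trees.* Let $\mathrm{DT}(V)$ be the vector space with basis all planar rooted trees other than the one-leaf tree $|$, in which every internal vertex has at least two children and a vertex with $n+1$ children is decorated by an element of $\Omega^{n}$. Every such tree is uniquely a grafting $T=T^{(0)}\vee_{x_1}\cdots\vee_{x_m}T^{(m)}$,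 $m\ge1$, of trees (possibly $|$). For this $T$ and $U=U^{(0)}\vee_{y_1}\cdots\vee_{y_n}U^{(n)}$ put, recursively, $$T\prec U=T^{(0)}\vee_{x_1}\cdots\vee_{x_m}(T^{(m)}\star U),\qquad T\succ U=(T\star U^{(0)})\vee_{y_1}\cdots\vee_{y_n}U^{(n)},$$ $$T\cdot U=T^{(0)}\vee_{x_1}\cdots\vee_{x_m}(T^{(m)}\star U^{(0)})\vee_{y_1}\cdots\vee_{y_n}U^{(n)},$$ where $\star=\prec+\succ+\cdot$, $|\star S=S\star|=S$ for every tree $S$, and grafting is extended linearly in each branch. Let $V\to \mathrm{DT}(V)$ be the linear map $x\mapsto|\vee_x|$ ($x\in\Omega$). *Words.* Let $T(V)=\bigoplus_{n\ge1}V^{\otimes n}$, with basis $X=M(\Omega)$, the free semigroup on $\Omega$. Let $\mathfrak X_\infty$ be the set of Rota-Baxter words on $X$: nonempty words whose letters are alternately elements of $X$ and brackets $\lfloor u\rfloor$ with $u\in\mathfrak X_\infty$. Let $Ш(T(V))$ be the vector space with basis $\mathfrak X_\infty$, with the operator $R(u)=\lfloor u\rfloor$ and the bilinear product $\diamond$ given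 on words by $p_1\cdots p_b\diamond q_1\cdots q_c=p_1\cdots p_{b-1}(p_b\diamond q_1)q_2\cdots q_c$, where $p_b\diamond q_1$ is the product in $T(V)$ if both lie in $X$, is the concatenation if exactly one lies in $X$, and $\lfloor u\rfloor\diamond\lfloor v\rfloor=\lfloor\lfloor u\rfloor\diamond v\rfloor+\lfloor u\diamond\lfloor v\rfloor\rfloor+\lfloor u\diamond v\rfloor$. Let $j_{T(V)}:T(V)\to Ш(T(V))$ be the linear map sending $x\in X$ to the one-letter word $x$, and $j$ its restriction to $V$. Define a linear map $\psi:\mathrm{DT}(V)\to Ш(T(V))$ recursively by $$\psi(T^{(0)}\vee_{x_1}\cdots\vee_{x_m}T^{(m)})=\lfloor\psi(T^{(0)})\rfloor x_1\lfloor\psi(T^{(1)})\rfloor x_2\cdots x_m\lfloor\psi(T^{(m)})\rfloor,$$ where, if $T^{(i)}=|$, the factor $\lfloor\psi(T^{(i)})\rfloor$ is dropped when $i=0$ or $i=m$, and is replaced by $\otimes$ when $0<i<m$. A word of $\mathfrak X_\infty$ is a dendriform triword if it is not of the form $\lfloor u\rfloor$ and has no subword $\lfloor\lfloor u\rfloor\rfloor$,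 with $u\in\mathfrak X_\infty$. **Theorem.** 1. $\mathrm{DT}(V)$, with $V\to\mathrm{DT}(V)$, is the free dendriform trialgebra over $V$. 2. $Ш(T(V))$, with $\diamond$, $R$ and $j_{T(V)}$, is the free nonunitary Rota-Baxter algebra of weight one over the nonunitary algebra $T(V)$; in particular it is a dendriform trialgebra under $\prec_R,\succ_R,\cdot_R$ (with $\lambda=1$). 3. $\psi:\mathrm{DT}(V)\to Ш(T(V))$ is a morphism of dendriform trialgebras. 4. $\psi$ is the morphism induced by $j$: the composite $V\to\mathrm{DT}(V)\xrightarrow{\psi}Ш(T(V))$ is $j$, and $\psi$ is the only morphism of dendriform trialgebras with this property. 5. The image of $\psi$ is the linear span of the dendriform triwords. 6. $\psi$ is injective. So the free dendriform trialgebra over $V$ is a canonical sub-trialgebra of the free Rota-Baxter algebra $Ш(T(V))$ of weight one. -/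

import Mathlib

universe u v w

namespace DendRB

open Module

noncomputable section

/-! ## Dendriform trialgebras and Rota-Baxter algebras -/

/-- The data of three bilinear operations `≺`, `≻`, `·` on a module. -/
structure TriOps (k : Type u) (D : Type v) [Field k] [AddCommGroup D] [Module k D] where
  prec : D →ₗ[k] D →ₗ[k] D
  succ : D →ₗ[k] D →ₗ[k] D
  dot : D →ₗ[k] D →ₗ[k] D

namespace TriOps

variable {k : Type*} [Field k]
variable {D : Type*} [AddCommGroup D] [Module k D]
variable {E : Type*} [AddCommGroup E] [Module k E]
variable {V : Type*} [AddCommGroup V] [Module k V]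

/-- `⋆ = ≺ + ≻ + ·`. -/
def star (o : TriOps k D) : D →ₗ[k] D →ₗ[k] D := o.prec + o.succ + o.dot

/-- The seven axioms of a dendriform trialgebra. -/
structure IsDendriform (o : TriOps k D) : Prop where
  prec_prec : ∀ x y z, o.prec (o.prec x y) z = o.prec x (o.star y z)
  succ_prec : ∀ x y z, o.prec (o.succ x y) z = o.succ x (o.prec y z)
  star_succ : ∀ x y z, o.succ (o.star x y) z = o.succ x (o.succ y z)
  succ_dot : ∀ x y z, o.dot (o.succ x y) z = o.succ x (o.dot y z)
  prec_dot : ∀ x y z, o.dot (o.prec x y) z = o.dot x (o.succ y z)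
  dot_prec : ∀ x y z, o.prec (o.dot x y) z = o.dot x (o.prec y z)
  dot_dot : ∀ x y z, o.dot (o.dot x y) z = o.dot x (o.dot y z)

/-- Morphisms of dendriform trialgebras: linear maps preserving the three operations. -/
structure IsHom (o : TriOps k D) (o' : TriOps k E) (f : D →ₗ[k] E) : Prop where
  map_prec : ∀ x y, f (o.prec x y) = o'.prec (f x) (f y)
  map_succ : ∀ x y, f (o.succ x y) = o'.succ (f x) (f y)
  map_dot : ∀ x y, f (o.dot x y) = o'.dot (f x) (f y)

/-- `(D, o)` with `i : V → D` is a free dendriform trialgebra over the vector space `V`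
(the universal property being tested on trialgebras in the universe `w`). -/
def IsFree (o : TriOps k D) (i : V →ₗ[k] D) : Prop :=
  o.IsDendriform ∧
    ∀ (E : Type w) [AddCommGroup E] [Module k E] (o' : TriOps k E), o'.IsDendriform →
      ∀ f : V →ₗ[k] E, ∃! g : D →ₗ[k] E, o.IsHom o' g ∧ g ∘ₗ i = f

end TriOps

/-- The data of a bilinear product and a linear operator on a module. -/
structure RBOps (k : Type u) (A : Type v) [Field k] [AddCommGroup A] [Module k A] where
  mul : A →ₗ[k] A →ₗ[k] A
  R : A →ₗ[k] A

namespace RBOps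

variable {k : Type*} [Field k]
variable {A : Type*} [AddCommGroup A] [Module k A]
variable {A' : Type*} [AddCommGroup A'] [Module k A']
variable {B : Type*} [NonUnitalRing B] [Module k B]

/-- Nonunitary Rota-Baxter algebras of weight `wt`: the product is associative and
`R(x) R(y) = R(R(x) y + x R(y) + wt x y)`. -/
structure IsRotaBaxter (o : RBOps k A) (wt : k) : Prop where
  assoc : ∀ x y z, o.mul (o.mul x y) z = o.mul x (o.mul y z)
  rota_baxter : ∀ x y,
    o.mul (o.R x) (o.R y) = o.R (o.mul (o.R x) y + o.mul x (o.R y) + wt • o.mul x y)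

/-- Morphisms of nonunitary Rota-Baxter algebras. -/
structure IsHom (o : RBOps k A) (o' : RBOps k A') (f : A →ₗ[k] A') : Prop where
  map_mul : ∀ x y, f (o.mul x y) = o'.mul (f x) (f y)
  map_R : ∀ x, f (o.R x) = o'.R (f x)

/-- A linear map from a nonunitary algebra `B` that is an algebra homomorphism. -/
def IsAlgHom (o : RBOps k A) (f : B →ₗ[k] A) : Prop :=
  ∀ x y, f (x * y) = o.mul (f x) (f y)

/-- `(A, o)` with `j : B → A` is a free nonunitary Rota-Baxter algebra of weight `wt` over the
nonunitary algebra `B` (the universal property being tested on Rota-Baxter algebras in the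
universe `w`). -/
def IsFree (o : RBOps k A) (wt : k) (j : B →ₗ[k] A) : Prop :=
  o.IsRotaBaxter wt ∧ o.IsAlgHom j ∧
    ∀ (A' : Type w) [AddCommGroup A'] [Module k A'] (o' : RBOps k A'), o'.IsRotaBaxter wt →
      ∀ f : B →ₗ[k] A', o'.IsAlgHom f →
        ∃! g : A →ₗ[k] A', o.IsHom o' g ∧ g ∘ₗ j = f

/-- The operations `x ≺ y = x R(y)`, `x ≻ y = R(x) y`, `x · y = wt x y` of a Rota-Baxter algebra
of weight `wt`. -/
def toTri (o : RBOps k A) (wt : k) : TriOps k A where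
  prec := o.mul.compl₂ o.R
  succ := o.mul ∘ₗ o.R
  dot := wt • o.mul

end RBOps

/-! ## Bilinear extension of an operation defined on bases -/

/-- The bilinear extension of `f : α × β → k[γ]`. -/
def bilin (k : Type*) [Field k] {α β γ : Type*} (f : α → β → (γ →₀ k)) :
    (α →₀ k) →ₗ[k] (β →₀ k) →ₗ[k] (γ →₀ k) :=
  Finsupp.linearCombination k fun a => Finsupp.linearCombination k (f a)

/-! ## The free Rota-Baxter algebra on an algebra with a basis -/

/-- Rota-Baxter bracketed words on the alphabet `X`: nonempty words whose letters are alternately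
an element of `X` or a bracket `⌊u⌋` enclosing another such word `u`.  The index is the head:
`false` if the first letter is in `X`, `true` if it is a bracket. -/
inductive Word (X : Type u) : Bool → Type u
  /-- the word `x` -/
  | letter (x : X) : Word X false
  /-- the word `⌊u⌋` -/
  | bracket {h : Bool} (u : Word X h) : Word X true
  /-- the word `x z`, where `z` starts with a bracket -/
  | letterCons (x : X) (z : Word X true) : Word X false
  /-- the word `⌊u⌋ z`, where `z` starts with an element of `X` -/
  | bracketCons {h : Bool} (u : Word X h) (z : Word X false) : Word X true

/-- The set of all Rota-Baxter words on `X`. -/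
abbrev RBWord (X : Type u) : Type u := Σ h : Bool, Word X h

namespace Word

variable {X : Type*}

/-- A measure of the size of a word, used for recursion. -/
def size : {h : Bool} → Word X h → ℕ
  | _, letter _ => 1
  | _, bracket u => u.size + 1
  | _, letterCons _ z => z.size + 1
  | _, bracketCons u z => u.size + z.size + 1

/-- The word is of the form `⌊u⌋`. -/
def IsBracket : {h : Bool} → Word X h → Prop
  | _, bracket _ => True
  | _, _ => False

/-- The word has no subword of the form `⌊⌊u⌋⌋`. -/
def NoDouble : {h : Bool} → Word X h → Prop
  | _, letter _ => True
  | _, bracket u => ¬ u.IsBracket ∧ u.NoDouble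
  | _, letterCons _ z => z.NoDouble
  | _, bracketCons u z => ¬ u.IsBracket ∧ u.NoDouble ∧ z.NoDouble

/-- Dendriform triwords: the word is not of the form `⌊u⌋`, and has no subword `⌊⌊u⌋⌋`. -/
def IsTriword {h : Bool} (z : Word X h) : Prop := ¬ z.IsBracket ∧ z.NoDouble

end Word

section Sha

variable {k : Type*} [Field k] {B : Type*} [NonUnitalRing B] [Module k B]
variable {X : Type*}

open Word in
/-- The product `⋄` of two Rota-Baxter words on a basis `X` of the algebra `B`, as a combination
of words: concatenation, except that adjacent letters in `X` are multiplied in `B`, and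
`⌊u⌋ ⋄ ⌊v⌋ = ⌊⌊u⌋ ⋄ v⌋ + ⌊u ⋄ ⌊v⌋⌋ + wt ⌊u ⋄ v⌋`.  The words of `p ⋄ q` have the head of `p`. -/
def mulWord (e : Basis X k B) (wt : k) : {h h' : Bool} → Word X h → Word X h' → (Word X h →₀ k)
  | _, _, letterCons x z, q => (mulWord e wt z q).mapDomain (letterCons x)
  | _, _, bracketCons u z, q => (mulWord e wt z q).mapDomain (bracketCons u)
  | _, _, letter x, letter y => (e.repr (e x * e y)).mapDomain letter
  | _, _, letter x, letterCons y q => (e.repr (e x * e y)).mapDomain fun a => letterCons a q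
  | _, _, letter x, bracket v => Finsupp.single (letterCons x (bracket v)) 1
  | _, _, letter x, bracketCons v q => Finsupp.single (letterCons x (bracketCons v q)) 1
  | _, _, bracket u, letter y => Finsupp.single (bracketCons u (letter y)) 1
  | _, _, bracket u, letterCons y q => Finsupp.single (bracketCons u (letterCons y q)) 1
  | _, _, bracket u, bracket v =>
      (mulWord e wt (bracket u) v).mapDomain bracket
        + (mulWord e wt u (bracket v)).mapDomain bracket
        + wt • (mulWord e wt u v).mapDomain bracket
  | _, _, bracket u, bracketCons v q =>
      (mulWord e wt (bracket u) v).mapDomain (fun a => bracketCons a q)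
        + (mulWord e wt u (bracket v)).mapDomain (fun a => bracketCons a q)
        + wt • (mulWord e wt u v).mapDomain (fun a => bracketCons a q)
termination_by _ _ p q => p.size + q.size
decreasing_by all_goals (simp only [Word.size]; omega)

/-- The vector space with basis the Rota-Baxter words on `X`. -/
abbrev Sha (k : Type*) [Field k] (X : Type*) : Type _ := RBWord X →₀ k

/-- The product `⋄` and the operator `R(u) = ⌊u⌋` on `Sha k X`, for the algebra `B` with
basis `X`. -/
def shaOps (e : Basis X k B) (wt : k) : RBOps k (Sha k X) where
  mul := bilin k fun p q : RBWord X => (mulWord e wt p.2 q.2).mapDomain (Sigma.mk p.1)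
  R := Finsupp.lmapDomain k k fun p : RBWord X => ⟨true, Word.bracket p.2⟩

/-- The map `j_B : B → Ш(B)` sending a basis element `x` to the one-letter word `x`. -/
def shaIncl (e : Basis X k B) : B →ₗ[k] Sha k X :=
  Finsupp.lmapDomain k k (fun x => (⟨false, Word.letter x⟩ : RBWord X)) ∘ₗ e.repr.toLinearMap

end Sha

/-! ## The nonunitary tensor algebra -/

section Tensor

variable {k : Type*} [Field k] {V : Type*} [AddCommGroup V] [Module k V] {Ω : Type*}

/-- The nonunitary tensor algebra `T(V) = ⨁_{n ≥ 1} V^{⊗ n}`: the nonunitary subalgebra of the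
tensor algebra generated by `V`. -/
abbrev TPos (k : Type*) [Field k] (V : Type*) [AddCommGroup V] [Module k V] : Type _ :=
  NonUnitalAlgebra.adjoin k (Set.range (TensorAlgebra.ι k : V → TensorAlgebra k V))

/-- The inclusion `V → T(V)`. -/
def tposIncl (k : Type*) [Field k] (V : Type*) [AddCommGroup V] [Module k V] :
    V →ₗ[k] TPos k V where
  toFun v := ⟨TensorAlgebra.ι k v, NonUnitalAlgebra.subset_adjoin k ⟨v, rfl⟩⟩
  map_add' _ _ := Subtype.ext (map_add _ _ _)
  map_smul' _ _ := Subtype.ext (map_smul _ _ _)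

/-- The pure tensor `x₁ ⊗ ⋯ ⊗ xₙ` in `T(V)` of a word `x₁ ⋯ xₙ` on the basis `Ω` of `V`. -/
def pureTensor (b : Basis Ω k V) : FreeSemigroup Ω →ₙ* TPos k V :=
  FreeSemigroup.lift fun x => tposIncl k V (b x)

theorem coe_pureTensor (b : Basis Ω k V) (s : FreeSemigroup Ω) :
    (pureTensor b s : TensorAlgebra k V) =
      b.tensorAlgebra (FreeMonoid.ofList (s.head :: s.tail)) := by
  have key : ∀ m : FreeMonoid Ω, b.tensorAlgebra m =
      FreeMonoid.lift (fun x => TensorAlgebra.ι k (b x)) m := by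
    intro m
    induction m using FreeMonoid.inductionOn' with
    | one =>
      simp [Basis.tensorAlgebra, FreeAlgebra.basisFreeMonoid,
        FreeAlgebra.equivMonoidAlgebraFreeMonoid]
    | of_mul x m ih =>
      rw [map_mul (FreeMonoid.lift fun x => TensorAlgebra.ι k (b x)), ← ih,
        FreeMonoid.lift_eval_of]
      simp [Basis.tensorAlgebra, FreeAlgebra.basisFreeMonoid,
        FreeAlgebra.equivMonoidAlgebraFreeMonoid]
  rw [key]
  induction s using FreeSemigroup.recOnMul with
  | ih1 x =>
    change TensorAlgebra.ι k (b x) = _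
    simp
  | ih2 x y _ ih =>
    rw [map_mul]
    change TensorAlgebra.ι k (b x) * (pureTensor b y : TensorAlgebra k V) = _
    rw [ih]
    change _ = FreeMonoid.lift _ (FreeMonoid.of x * FreeMonoid.ofList (y.head :: y.tail))
    rw [map_mul, FreeMonoid.lift_eval_of]

theorem pureTensor_linearIndependent (b : Basis Ω k V) :
    LinearIndependent k (pureTensor b) := by
  have inj : Function.Injective
      (fun s : FreeSemigroup Ω => FreeMonoid.ofList (s.head :: s.tail)) := by
    intro s t h
    have h' : s.head :: s.tail = t.head :: t.tail := FreeMonoid.ofList.injective h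
    exact FreeSemigroup.ext (List.cons.inj h').1 (List.cons.inj h').2
  have h := b.tensorAlgebra.linearIndependent.comp _ inj
  refine LinearIndependent.of_comp
    (NonUnitalSubalgebra.toSubmodule (NonUnitalAlgebra.adjoin k
      (Set.range (TensorAlgebra.ι k : V → TensorAlgebra k V)))).subtype ?_
  have e : (fun s => (pureTensor b s : TensorAlgebra k V)) =
      b.tensorAlgebra ∘ fun s : FreeSemigroup Ω => FreeMonoid.ofList (s.head :: s.tail) :=
    funext fun s => coe_pureTensor b s
  rw [← e] at h
  exact h

theorem pureTensor_span (b : Basis Ω k V) :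
    ⊤ ≤ Submodule.span k (Set.range (pureTensor b)) := by
  rintro ⟨a, ha⟩ -
  induction ha using NonUnitalAlgebra.adjoin_induction with
  | mem x hx =>
    obtain ⟨v, rfl⟩ := hx
    change tposIncl k V v ∈ _
    rw [← b.linearCombination_repr v, Finsupp.linearCombination_apply, Finsupp.sum, map_sum]
    refine Submodule.sum_mem _ fun i _ => ?_
    rw [map_smul]
    exact Submodule.smul_mem _ _ (Submodule.subset_span ⟨FreeSemigroup.of i, rfl⟩)
  | zero => exact Submodule.zero_mem _
  | add x y hx hy h1 h2 => exact Submodule.add_mem _ h1 h2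
  | smul r x hx h => exact Submodule.smul_mem _ r h
  | mul x y hx hy h1 h2 =>
    change (⟨x, hx⟩ * ⟨y, hy⟩ : TPos k V) ∈ _
    generalize (⟨x, hx⟩ : TPos k V) = x at h1
    generalize (⟨y, hy⟩ : TPos k V) = y at h2
    induction h1 using Submodule.span_induction with
    | zero => simp
    | add p q _ _ hp hq => rw [add_mul]; exact Submodule.add_mem _ hp hq
    | smul r p _ hp => rw [smul_mul_assoc]; exact Submodule.smul_mem _ r hp
    | mem p hp =>
      obtain ⟨s, rfl⟩ := hp
      induction h2 using Submodule.span_induction with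
      | zero => simp
      | add p q _ _ hp hq => rw [mul_add]; exact Submodule.add_mem _ hp hq
      | smul r p _ hp => rw [mul_smul_comm]; exact Submodule.smul_mem _ r hp
      | mem p hp =>
        obtain ⟨t, rfl⟩ := hp
        rw [← map_mul]
        exact Submodule.subset_span ⟨s * t, rfl⟩

/-- The basis `M(Ω)` (the free semigroup on `Ω`) of `T(V)` given by a basis `Ω` of `V`. -/
def tposBasis (b : Basis Ω k V) : Basis (FreeSemigroup Ω) k (TPos k V) :=
  Basis.mk (pureTensor_linearIndependent b) (pureTensor_span b)

end Tensor

/-! ## Valently decorated planar trees -/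

mutual
/-- Planar trees whose internal vertices have at least two children, valently decorated by `Ω`:
a vertex with `n + 1` children is decorated by an `n`-tuple of elements of `Ω`. -/
inductive Tree (Ω : Type u) : Type u
  /-- the tree `|` with one leaf -/
  | leaf : Tree Ω
  /-- a tree other than `|` -/
  | node (t : Node Ω) : Tree Ω
/-- The decorated trees `T₀ ∨_{x₁} T₁ ∨_{x₂} ⋯ ∨_{xₙ} Tₙ`, `n ≥ 1`, other than `|`. -/
inductive Node (Ω : Type u) : Type u
  /-- `two T₀ x T₁` is the grafting `T₀ ∨_x T₁` -/
  | two (l : Tree Ω) (x : Ω) (r : Tree Ω) : Node Ω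
  /-- for `t = T₁ ∨_{x₂} ⋯ ∨_{xₙ} Tₙ`, `cons T₀ x₁ t` is the grafting
  `T₀ ∨_{x₁} T₁ ∨_{x₂} ⋯ ∨_{xₙ} Tₙ` with a single root vertex -/
  | cons (l : Tree Ω) (x : Ω) (t : Node Ω) : Node Ω
end

namespace Node

variable {Ω : Type*}

/-- The first branch `T₀` of the root. -/
def first : Node Ω → Tree Ω
  | two l _ _ => l
  | cons l _ _ => l

/-- The last branch `Tₙ` of the root. -/
def last : Node Ω → Tree Ω
  | two _ _ r => r
  | cons _ _ t => t.last

/-- Replace the first branch of the root by `S`. -/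
def setFirst (S : Tree Ω) : Node Ω → Node Ω
  | two _ x r => two S x r
  | cons _ x t => cons S x t

/-- Replace the last branch of the root by `S`. -/
def setLast (S : Tree Ω) : Node Ω → Node Ω
  | two l x _ => two l x S
  | cons l x t => cons l x (t.setLast S)

/-- `fuse T S U` is `T₀ ∨_{x₁} ⋯ ∨_{xₘ} S ∨_{y₁} U₁ ∨ ⋯ ∨_{yₙ} Uₙ`: the last branch of `T` and the
first branch of `U` are replaced by one common branch `S`. -/
def fuse (S : Tree Ω) (U : Node Ω) : Node Ω → Node Ω
  | two l x _ => cons l x (U.setFirst S)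
  | cons l x t => cons l x (fuse S U t)

end Node

mutual
/-- The number of elements of `Ω` in the decorations (one less than the number of leaves). -/
def Tree.size {Ω : Type*} : Tree Ω → ℕ
  | .leaf => 0
  | .node t => t.size
/-- The number of elements of `Ω` in the decorations (one less than the number of leaves). -/
def Node.size {Ω : Type*} : Node Ω → ℕ
  | .two l _ r => l.size + 1 + r.size
  | .cons l _ t => l.size + 1 + t.size
end

theorem Node.size_first_lt {Ω : Type*} (t : Node Ω) : t.first.size < t.size := by
  cases t <;> simp only [Node.first, Node.size] <;> omega

theorem Node.size_last_lt {Ω : Type*} : (t : Node Ω) → t.last.size < t.size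
  | .two _ _ _ => by simp only [Node.last, Node.size]; omega
  | .cons _ _ t => by
      have := Node.size_last_lt t
      simp only [Node.last, Node.size]; omega

section DT

variable {Ω : Type*}

/-- The operation `⋆ = ≺ + ≻ + ·` on trees, with `| ⋆ T = T ⋆ | = T`, as a combination of trees;
the three summands in the last case are `T ≺ U`, `T ≻ U` and `T · U`. -/
def starTree (k : Type*) [Field k] : Tree Ω → Tree Ω → (Tree Ω →₀ k)
  | .leaf, U => Finsupp.single U 1
  | .node t, .leaf => Finsupp.single (.node t) 1
  | .node t, .node s =>
      (starTree k t.last (.node s)).mapDomain (fun S => .node (t.setLast S))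
        + (starTree k (.node t) s.first).mapDomain (fun S => .node (s.setFirst S))
        + (starTree k t.last s.first).mapDomain (fun S => .node (Node.fuse S s t))
termination_by T U => T.size + U.size
decreasing_by
  all_goals
    have h1 := t.size_last_lt
    have h2 := s.size_first_lt
    simp only [Tree.size]
    omega

/-- The vector space with basis the decorated trees other than `|`. -/
abbrev DT (k : Type*) [Field k] (Ω : Type*) : Type _ := Node Ω →₀ k

/-- The operations of the dendriform trialgebra of decorated trees.  With
`T = T₀ ∨_{x₁} ⋯ ∨_{xₘ} Tₘ` and `U = U₀ ∨_{y₁} ⋯ ∨_{yₙ} Uₙ`,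
`T ≺ U = T₀ ∨ ⋯ ∨_{xₘ} (Tₘ ⋆ U)`, `T ≻ U = (T ⋆ U₀) ∨_{y₁} ⋯ ∨ Uₙ` and
`T · U = T₀ ∨ ⋯ ∨_{xₘ} (Tₘ ⋆ U₀) ∨_{y₁} ⋯ ∨ Uₙ`. -/
def dtOps (k : Type*) [Field k] (Ω : Type*) : TriOps k (DT k Ω) where
  prec := bilin k fun t s => (starTree k t.last (.node s)).mapDomain fun S => t.setLast S
  succ := bilin k fun t s => (starTree k (.node t) s.first).mapDomain fun S => s.setFirst S
  dot := bilin k fun t s => (starTree k t.last s.first).mapDomain fun S => Node.fuse S s t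

/-- The map `V → DT(V)` sending a basis element `x` to the tree `| ∨_x |`. -/
def dtIncl {k : Type*} [Field k] {V : Type*} [AddCommGroup V] [Module k V] (b : Basis Ω k V) :
    V →ₗ[k] DT k Ω :=
  Finsupp.lmapDomain k k (fun x => Node.two .leaf x .leaf) ∘ₗ b.repr.toLinearMap

end DT

/-! ## The map `ψ` -/

section Psi

variable {Ω : Type*}

/-- Put the letter `x` in front of a word on `M(Ω)`: if the word starts with a letter `y` the
result starts with the letter `x ⊗ y`, otherwise `x` becomes a new first letter. -/
def prepend (x : Ω) : {h : Bool} → Word (FreeSemigroup Ω) h → Word (FreeSemigroup Ω) false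
  | _, .letter y => .letter (FreeSemigroup.of x * y)
  | _, .letterCons y z => .letterCons (FreeSemigroup.of x * y) z
  | _, .bracket u => .letterCons (FreeSemigroup.of x) (.bracket u)
  | _, .bracketCons u z => .letterCons (FreeSemigroup.of x) (.bracketCons u z)

/-- Put `⌊p⌋` in front of a word starting with a letter; nothing if `p` is absent. -/
def prependBracket {X : Type*} : Option (RBWord X) → Word X false → RBWord X
  | none, z => ⟨false, z⟩
  | some p, z => ⟨true, .bracketCons p.2 z⟩

/-- The word `x ⌊p⌋`; the word `x` if `p` is absent. -/
def appendBracket {X : Type*} (x : X) : Option (RBWord X) → Word X false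
  | none => .letter x
  | some p => .letterCons x (.bracket p.2)

mutual
/-- `psiNode T` is the word `⌊ψ(T₀)⌋ x₁ ⌊ψ(T₁)⌋ ⋯ xₙ ⌊ψ(Tₙ)⌋`, where for `Tᵢ = |` the factor
`⌊ψ(Tᵢ)⌋` is dropped if `i = 0` or `i = n` and replaced by `⊗` if `0 < i < n`. -/
def psiNode : Node Ω → RBWord (FreeSemigroup Ω)
  | .two l x r => prependBracket (psiTree l) (appendBracket (FreeSemigroup.of x) (psiTree r))
  | .cons l x t => prependBracket (psiTree l) (prepend x (psiNode t).2)
/-- The word `ψ(T)`, absent for `T = |`. -/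
def psiTree : Tree Ω → Option (RBWord (FreeSemigroup Ω))
  | .leaf => none
  | .node t => some (psiNode t)
end

/-- The linear map `ψ : DT(V) → Ш(T(V))`. -/
def psi (k : Type*) [Field k] (Ω : Type*) : DT k Ω →ₗ[k] Sha k (FreeSemigroup Ω) :=
  Finsupp.lmapDomain k k psiNode

/-- The span `TW(V)` of the dendriform triwords. -/
def triwordSpan (k : Type*) [Field k] (X : Type*) : Submodule k (Sha k X) :=
  Submodule.span k {a | ∃ p : RBWord X, p.2.IsTriword ∧ a = Finsupp.single p 1}

end Psi

end

end DendRB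

namespace DendRB

open Module

noncomputable section

-- Linear extension from basis vectors

section Linear

variable {k : Type*} [Field k] {α β γ : Type*}

-- The product `⋄` is recursive on the total size of two words, and every statement about it is an
-- induction on that size. Associativity is interesting only for three words meeting at brackets:
-- expanding both bracketings of ⌊u⌋⌊v⌋⌊w⌋ by the Rota-Baxter rule leaves seven instances of
-- associativity for smaller words (`mulLin_assoc_single`). Freeness holds because each word is
-- built from letters by `⋄` and `R`, which forces the lift, and the lift is multiplicative by an
-- induction following the recursion of `⋄` (`shaLift_mulLin_single`).
--
-- On trees, the lift to a trialgebra E is forced by T₀ ∨_{x₁} ⋯ ∨_{xₘ} Tₘ = (T₀ ≻ x₁) · (T₁ ≻ x₂) ·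
-- ⋯ · ((Tₘ₋₁ ≻ xₘ) ≺ Tₘ). Since | has no value in E, a branch is represented by its left `≻`
-- operator and its right `≺` operator, with | acting as the identity; the heart is that `⋆` becomes
-- composition of these operators (`treeLin_starTree`). The seven axioms of E are what this needs,
-- and no axiom for trees is used.
--
-- Hence the lift of x ↦ x into the Rota-Baxter algebra, whose trialgebra axioms follow from
-- `RBOps.IsRotaBaxter.toTri_isDendriform`, is already known to preserve the operations. It equals ψ
-- (`psi_eq_dtLift`), and ψ is injective because it maps basis trees injectively to words: a tree
-- can be read off its word (`psiNode_injective`). The trialgebra axioms for trees are then pulled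
-- back along ψ, avoiding any direct verification, and freeness follows. The image is found by the
-- converse reading, from triwords to trees (`exists_psiNode`).

theorem finsupp_induction {p : (α →₀ k) → Prop} (f : α →₀ k) (zero : p 0)
    (add : ∀ f g, p f → p g → p (f + g)) (smul : ∀ (c : k) f, p f → p (c • f))
    (single : ∀ a, p (Finsupp.single a 1)) : p f := by
  induction f using Finsupp.induction_linear with
  | zero => exact zero
  | add f g hf hg => exact add f g hf hg
  | single a c => simpa using smul c _ (single a)

theorem basis_induction {B : Type*} [AddCommGroup B] [Module k B] (e : Basis α k B)
    {p : B → Prop} (b : B) (zero : p 0)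
    (add : ∀ f g, p f → p g → p (f + g)) (smul : ∀ (c : k) f, p f → p (c • f))
    (basis : ∀ a, p (e a)) : p b := by
  rw [← e.repr.symm_apply_apply b]
  induction e.repr b using finsupp_induction with
  | zero => simpa using zero
  | add f g hf hg => simpa using add _ _ hf hg
  | smul c f hf => simpa using smul c _ hf
  | single a => simpa using basis a

@[simp]
theorem bilin_single (f : α → β → (γ →₀ k)) (a : α) (b : β) :
    bilin k f (Finsupp.single a 1) (Finsupp.single b 1) = f a b := by
  simp [bilin]

theorem map_bilinear_of_single {E : Type*} [AddCommGroup E] [Module k E] {g : (α →₀ k) →ₗ[k] E}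
    {m : (α →₀ k) →ₗ[k] (α →₀ k) →ₗ[k] (α →₀ k)} {m' : E →ₗ[k] E →ₗ[k] E}
    (h : ∀ a b, g (m (Finsupp.single a 1) (Finsupp.single b 1)) =
      m' (g (Finsupp.single a 1)) (g (Finsupp.single b 1))) (x y : α →₀ k) :
    g (m x y) = m' (g x) (g y) := by
  induction x using finsupp_induction with
  | zero => simp
  | add f g hf hg => simp only [map_add, LinearMap.add_apply, hf, hg]
  | smul c f hf => simp only [map_smul, LinearMap.smul_apply, hf]
  | single t =>
  induction y using finsupp_induction with
  | zero => simp
  | add f g hf hg => simp only [map_add, hf, hg]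
  | smul c f hf => simp only [map_smul, hf]
  | single s => exact h t s

end Linear

-- The product `⋄` and its associativity

section ShaProduct

variable {k : Type*} [Field k] {B : Type*} [NonUnitalRing B] [Module k B]
variable {X : Type*}

/-- The linear extension of `u ↦ ⌊u⌋`. -/
def bracketLin (k : Type*) [Field k] {X : Type*} (h : Bool) :
    (Word X h →₀ k) →ₗ[k] (Word X true →₀ k) :=
  Finsupp.lmapDomain k k Word.bracket

/-- The linear extension of `(u, z) ↦ ⌊u⌋ z`. -/
def bracketConsLin (k : Type*) [Field k] {X : Type*} (h : Bool) :
    (Word X h →₀ k) →ₗ[k] (Word X false →₀ k) →ₗ[k] (Word X true →₀ k) :=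
  bilin k fun u z => Finsupp.single (Word.bracketCons u z) 1

/-- The linear extension of the inclusion of one-letter words. -/
def letterLin (e : Basis X k B) : B →ₗ[k] (Word X false →₀ k) :=
  Finsupp.lmapDomain k k Word.letter ∘ₗ e.repr.toLinearMap

/-- The linear extension of `(x, z) ↦ x z`. -/
def letterConsLin (e : Basis X k B) :
    B →ₗ[k] (Word X true →₀ k) →ₗ[k] (Word X false →₀ k) :=
  (bilin k fun x z => Finsupp.single (Word.letterCons x z) 1) ∘ₗ e.repr.toLinearMap

/-- The bilinear extension of the product of words with given heads. -/
def mulLin (e : Basis X k B) (wt : k) (h h' : Bool) :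
    (Word X h →₀ k) →ₗ[k] (Word X h' →₀ k) →ₗ[k] (Word X h →₀ k) :=
  bilin k (mulWord e wt)

@[simp]
theorem bracketLin_single {h : Bool} (u : Word X h) :
    bracketLin k h (Finsupp.single u 1) = Finsupp.single (Word.bracket u) 1 := by
  simp [bracketLin]

@[simp]
theorem bracketConsLin_single {h : Bool} (u : Word X h) (z : Word X false) :
    bracketConsLin k h (Finsupp.single u 1) (Finsupp.single z 1) =
      Finsupp.single (Word.bracketCons u z) 1 := by
  simp [bracketConsLin]

@[simp]
theorem letterLin_basis (e : Basis X k B) (x : X) :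
    letterLin e (e x) = Finsupp.single (Word.letter x) 1 := by
  simp [letterLin]

@[simp]
theorem letterConsLin_basis (e : Basis X k B) (x : X) (z : Word X true) :
    letterConsLin e (e x) (Finsupp.single z 1) = Finsupp.single (Word.letterCons x z) 1 := by
  simp [letterConsLin]

@[simp]
theorem mulLin_single (e : Basis X k B) (wt : k) {h h' : Bool} (p : Word X h) (q : Word X h') :
    mulLin e wt h h' (Finsupp.single p 1) (Finsupp.single q 1) = mulWord e wt p q := by
  simp [mulLin]

theorem mapDomain_bracketCons_left {h : Bool} (m : Word X h →₀ k) (z : Word X false) :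
    m.mapDomain (fun a => Word.bracketCons a z) = bracketConsLin k h m (Finsupp.single z 1) := by
  induction m using finsupp_induction with
  | zero => simp
  | add f g hf hg => simp [Finsupp.mapDomain_add, hf, hg]
  | smul c f hf => simp [Finsupp.mapDomain_smul, hf]
  | single a => simp

theorem mapDomain_bracketCons_right {h : Bool} (u : Word X h) (m : Word X false →₀ k) :
    m.mapDomain (Word.bracketCons u) = bracketConsLin k h (Finsupp.single u 1) m := by
  induction m using finsupp_induction with
  | zero => simp
  | add f g hf hg => simp [Finsupp.mapDomain_add, hf, hg]
  | smul c f hf => simp [Finsupp.mapDomain_smul, hf]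
  | single a => simp

theorem mapDomain_letterCons_right (e : Basis X k B) (x : X) (m : Word X true →₀ k) :
    m.mapDomain (Word.letterCons x) = letterConsLin e (e x) m := by
  induction m using finsupp_induction with
  | zero => simp
  | add f g hf hg => simp [Finsupp.mapDomain_add, hf, hg]
  | smul c f hf => simp [Finsupp.mapDomain_smul, hf]
  | single a => simp

theorem mapDomain_letterCons_left (e : Basis X k B) (b : B) (z : Word X true) :
    (e.repr b).mapDomain (fun a => Word.letterCons a z) =
      letterConsLin e b (Finsupp.single z 1) := by
  induction b using basis_induction e with
  | zero => simp
  | add f g hf hg => simp [Finsupp.mapDomain_add, hf, hg]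
  | smul c f hf => simp [Finsupp.mapDomain_smul, hf]
  | basis a => simp

variable (e : Basis X k B) (wt : k)

-- The recursion of `⋄` as multilinear identities

section Rules

theorem mulLin_letterCons {h : Bool} (b : B) (z : Word X true →₀ k) (q : Word X h →₀ k) :
    mulLin e wt false h (letterConsLin e b z) q =
      letterConsLin e b (mulLin e wt true h z q) := by
  induction b using basis_induction e with
  | zero => simp
  | add f g hf hg => simp only [map_add, LinearMap.add_apply, hf, hg]
  | smul c f hf => simp only [map_smul, LinearMap.smul_apply, hf]
  | basis x =>
  induction z using finsupp_induction with
  | zero => simp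
  | add f g hf hg => simp only [map_add, LinearMap.add_apply, hf, hg]
  | smul c f hf => simp only [map_smul, LinearMap.smul_apply, hf]
  | single z =>
  induction q using finsupp_induction with
  | zero => simp
  | add f g hf hg => simp only [map_add, hf, hg]
  | smul c f hf => simp only [map_smul, hf]
  | single q => simp [mulWord, mapDomain_letterCons_right e]

theorem mulLin_bracketCons {h h' : Bool} (u : Word X h →₀ k) (z : Word X false →₀ k)
    (q : Word X h' →₀ k) :
    mulLin e wt true h' (bracketConsLin k h u z) q =
      bracketConsLin k h u (mulLin e wt false h' z q) := by
  induction u using finsupp_induction with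
  | zero => simp
  | add f g hf hg => simp only [map_add, LinearMap.add_apply, hf, hg]
  | smul c f hf => simp only [map_smul, LinearMap.smul_apply, hf]
  | single u =>
  induction z using finsupp_induction with
  | zero => simp
  | add f g hf hg => simp only [map_add, LinearMap.add_apply, hf, hg]
  | smul c f hf => simp only [map_smul, LinearMap.smul_apply, hf]
  | single z =>
  induction q using finsupp_induction with
  | zero => simp
  | add f g hf hg => simp only [map_add, hf, hg]
  | smul c f hf => simp only [map_smul, hf]
  | single q => simp [mulWord, mapDomain_bracketCons_right]

theorem mulLin_letter_true (b : B) (z : Word X true →₀ k) :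
    mulLin e wt false true (letterLin e b) z = letterConsLin e b z := by
  induction b using basis_induction e with
  | zero => simp
  | add f g hf hg => simp only [map_add, LinearMap.add_apply, hf, hg]
  | smul c f hf => simp only [map_smul, LinearMap.smul_apply, hf]
  | basis x =>
  induction z using finsupp_induction with
  | zero => simp
  | add f g hf hg => simp only [map_add, hf, hg]
  | smul c f hf => simp only [map_smul, hf]
  | single z => cases z <;> simp [mulWord]

theorem mulLin_bracket_false {h : Bool} (u : Word X h →₀ k) (z : Word X false →₀ k) :
    mulLin e wt true false (bracketLin k h u) z = bracketConsLin k h u z := by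
  induction u using finsupp_induction with
  | zero => simp
  | add f g hf hg => simp only [map_add, LinearMap.add_apply, hf, hg]
  | smul c f hf => simp only [map_smul, LinearMap.smul_apply, hf]
  | single u =>
  induction z using finsupp_induction with
  | zero => simp
  | add f g hf hg => simp only [map_add, hf, hg]
  | smul c f hf => simp only [map_smul, hf]
  | single z => cases z <;> simp [mulWord]

/-- In multilinear form the Rota-Baxter rule can be applied again to the combinations it produces,
which iterated products need. -/
theorem mulLin_bracket_bracket {h h' : Bool} (u : Word X h →₀ k) (v : Word X h' →₀ k) :
    mulLin e wt true true (bracketLin k h u) (bracketLin k h' v) =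
      bracketLin k true (mulLin e wt true h' (bracketLin k h u) v)
        + bracketLin k h (mulLin e wt h true u (bracketLin k h' v))
        + wt • bracketLin k h (mulLin e wt h h' u v) := by
  induction u using finsupp_induction with
  | zero => simp
  | add f g hf hg => simp only [map_add, LinearMap.add_apply, hf, hg]; module
  | smul c f hf => simp only [map_smul, LinearMap.smul_apply, hf]; module
  | single u =>
  induction v using finsupp_induction with
  | zero => simp
  | add f g hf hg => simp only [map_add, hf, hg]; module
  | smul c f hf => simp only [map_smul, hf]; module
  | single v => simp [mulWord]; rfl

theorem mulLin_bracket_bracketCons {h h' : Bool} (u : Word X h →₀ k) (v : Word X h' →₀ k)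
    (z : Word X false →₀ k) :
    mulLin e wt true true (bracketLin k h u) (bracketConsLin k h' v z) =
      bracketConsLin k true (mulLin e wt true h' (bracketLin k h u) v) z
        + bracketConsLin k h (mulLin e wt h true u (bracketLin k h' v)) z
        + wt • bracketConsLin k h (mulLin e wt h h' u v) z := by
  induction u using finsupp_induction with
  | zero => simp
  | add f g hf hg => simp only [map_add, LinearMap.add_apply, hf, hg]; module
  | smul c f hf => simp only [map_smul, LinearMap.smul_apply, hf]; module
  | single u =>
  induction v using finsupp_induction with
  | zero => simp
  | add f g hf hg => simp only [map_add, LinearMap.add_apply, hf, hg]; module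
  | smul c f hf => simp only [map_smul, LinearMap.smul_apply, hf]; module
  | single v =>
  induction z using finsupp_induction with
  | zero => simp
  | add f g hf hg => simp only [map_add, hf, hg]; module
  | smul c f hf => simp only [map_smul, hf]; module
  | single z => simp [mulWord, mapDomain_bracketCons_left]

variable [IsScalarTower k B B] [SMulCommClass k B B]

theorem mulLin_letter_letter (a b : B) :
    mulLin e wt false false (letterLin e a) (letterLin e b) = letterLin e (a * b) := by
  induction a using basis_induction e with
  | zero => simp
  | add f g hf hg => simp only [map_add, LinearMap.add_apply, add_mul, hf, hg]
  | smul c f hf => simp only [map_smul, LinearMap.smul_apply, smul_mul_assoc, hf]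
  | basis x =>
  induction b using basis_induction e with
  | zero => simp
  | add f g hf hg => simp only [map_add, mul_add, hf, hg]
  | smul c f hf => simp only [map_smul, mul_smul_comm, hf]
  | basis y => simp [mulWord]; rfl

theorem mulLin_letter_letterCons (a b : B) (z : Word X true →₀ k) :
    mulLin e wt false false (letterLin e a) (letterConsLin e b z) =
      letterConsLin e (a * b) z := by
  induction a using basis_induction e with
  | zero => simp
  | add f g hf hg => simp only [map_add, LinearMap.add_apply, add_mul, hf, hg]
  | smul c f hf => simp only [map_smul, LinearMap.smul_apply, smul_mul_assoc, hf]
  | basis x =>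
  induction b using basis_induction e with
  | zero => simp
  | add f g hf hg => simp only [map_add, LinearMap.add_apply, mul_add, hf, hg]
  | smul c f hf => simp only [map_smul, LinearMap.smul_apply, mul_smul_comm, hf]
  | basis y =>
  induction z using finsupp_induction with
  | zero => simp
  | add f g hf hg => simp only [map_add, hf, hg]
  | smul c f hf => simp only [map_smul, hf]
  | single z => simp [mulWord, mapDomain_letterCons_left]

end Rules

variable [IsScalarTower k B B] [SMulCommClass k B B]

-- Induction on the total size. A composite left factor gives up its first letter; if the middle
-- factor is a single letter from X or a composite word, the two junctions do not interact beyond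
-- associativity of B. What remains is bracket against bracket in the middle.
open Word Finsupp in
theorem mulLin_assoc_single (n : ℕ) : ∀ {h h' h'' : Bool} (p : Word X h) (q : Word X h')
    (r : Word X h''), p.size + q.size + r.size ≤ n →
    mulLin e wt h h'' (mulLin e wt h h' (single p 1) (single q 1)) (single r 1) =
      mulLin e wt h h' (single p 1) (mulLin e wt h' h'' (single q 1) (single r 1)) := by
  induction n with
  | zero =>
    intro h h' h'' p q r hn
    -- Every word has size at least one, so the bound 0 is impossible.
    cases p <;> simp [Word.size] at hn
  | succ n ih =>
    intro h h' h'' p q r hn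
    rcases p with x | u | ⟨x, z⟩ | ⟨u, z⟩
    · rw [← letterLin_basis e]
      rcases q with y | v | ⟨y, z⟩ | ⟨v, z⟩
      · rw [← letterLin_basis e]
        rcases r with t | w | ⟨t, z⟩ | ⟨w, z⟩
        · rw [← letterLin_basis e]
          simp only [mulLin_letter_letter, mul_assoc]
        · simp only [mulLin_letter_letter, mulLin_letter_true, mulLin_letter_letterCons]
        · rw [← letterConsLin_basis e]
          simp only [mulLin_letter_letter, mulLin_letter_letterCons, mul_assoc]
        · simp only [mulLin_letter_letter, mulLin_letter_true, mulLin_letter_letterCons]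
      · simp only [mulLin_letter_true, mulLin_letterCons]
      · rw [← letterConsLin_basis e]
        simp only [mulLin_letter_letterCons, mulLin_letterCons]
      · simp only [mulLin_letter_true, mulLin_letterCons]
    · rw [← bracketLin_single]
      rcases q with y | v | ⟨y, z⟩ | ⟨v, z⟩
      · simp only [mulLin_bracket_false, mulLin_bracketCons]
      · rw [← bracketLin_single]
        rcases r with t | w | ⟨t, z⟩ | ⟨w, z⟩
        · simp only [mulLin_bracket_false, mulLin_bracket_bracket, mulLin_bracket_bracketCons,
            map_add, map_smul, LinearMap.add_apply, LinearMap.smul_apply]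
        · simp only [size] at hn
          -- Two applications of the Rota-Baxter rule to each side of ⌊u⌋⌊v⌋⌊w⌋ give the instances
          -- with two brackets (`h1` to `h3`, weight 1), one bracket (`h4` to `h6`, weight `wt`) and
          -- none (`h7`, weight `wt * wt`), all under an outer bracket.
          have h1 := congrArg (bracketLin k _)
            (ih (bracket u) (bracket v) w (by simp only [size]; omega))
          have h2 := congrArg (bracketLin k _)
            (ih (bracket u) v (bracket w) (by simp only [size]; omega))
          have h3 := congrArg (bracketLin k _)
            (ih u (bracket v) (bracket w) (by simp only [size]; omega))
          have h4 := congrArg (bracketLin k _) (ih (bracket u) v w (by simp only [size]; omega))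
          have h5 := congrArg (bracketLin k _) (ih u (bracket v) w (by simp only [size]; omega))
          have h6 := congrArg (bracketLin k _) (ih u v (bracket w) (by simp only [size]; omega))
          have h7 := congrArg (bracketLin k _) (ih u v w (by omega))
          -- Basis words are turned back into values of `bracketLin` so that the multilinear rules
          -- match.
          simp only [← bracketLin_single] at h1 h2 h3 h4 h5 h6 ⊢
          simp only [mulLin_bracket_bracket, map_add, map_smul,
            LinearMap.add_apply, LinearMap.smul_apply] at h1 h2 h3 ⊢
          linear_combination (norm := module) h1 + h2 + h3 + wt • (h4 + h5 + h6) + (wt * wt) • h7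
        · simp only [mulLin_bracket_false, mulLin_bracket_bracket, mulLin_bracket_bracketCons,
            map_add, map_smul, LinearMap.add_apply, LinearMap.smul_apply]
        · simp only [size] at hn
          -- The same seven instances; the tail z stays outside the outer bracket and is untouched.
          have h1 := congrArg (fun m => bracketConsLin k _ m (single z 1))
            (ih (bracket u) (bracket v) w (by simp only [size]; omega))
          have h2 := congrArg (fun m => bracketConsLin k _ m (single z 1))
            (ih (bracket u) v (bracket w) (by simp only [size]; omega))
          have h3 := congrArg (fun m => bracketConsLin k _ m (single z 1))
            (ih u (bracket v) (bracket w) (by simp only [size]; omega))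
          have h4 := congrArg (fun m => bracketConsLin k _ m (single z 1))
            (ih (bracket u) v w (by simp only [size]; omega))
          have h5 := congrArg (fun m => bracketConsLin k _ m (single z 1))
            (ih u (bracket v) w (by simp only [size]; omega))
          have h6 := congrArg (fun m => bracketConsLin k _ m (single z 1))
            (ih u v (bracket w) (by simp only [size]; omega))
          have h7 := congrArg (fun m => bracketConsLin k _ m (single z 1)) (ih u v w (by omega))
          simp only [← bracketLin_single, ← bracketConsLin_single] at h1 h2 h3 h4 h5 h6 ⊢
          simp only [mulLin_bracket_bracket, mulLin_bracket_bracketCons, map_add, map_smul,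
            LinearMap.add_apply, LinearMap.smul_apply] at h1 h2 h3 ⊢
          linear_combination (norm := module) h1 + h2 + h3 + wt • (h4 + h5 + h6) + (wt * wt) • h7
      · simp only [mulLin_bracket_false, mulLin_bracketCons]
      · rw [← bracketConsLin_single]
        simp only [mulLin_bracket_bracketCons, mulLin_bracketCons, map_add, map_smul,
          LinearMap.add_apply, LinearMap.smul_apply]
    · simp only [size] at hn
      rw [← letterConsLin_basis e]
      simp only [mulLin_letterCons, ih z q r (by omega)]
    · simp only [size] at hn
      rw [← bracketConsLin_single]
      simp only [mulLin_bracketCons, ih z q r (by omega)]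

end ShaProduct


-- Freeness of the Rota-Baxter algebra of words

section ShaFree

variable {k : Type*} [Field k] {B : Type*} [NonUnitalRing B] [Module k B]
variable {X : Type*} (e : Basis X k B) (wt : k)

/-- The inclusion of the combinations of words with head `h` into all combinations of words. -/
def headIncl (k : Type*) [Field k] {X : Type*} (h : Bool) : (Word X h →₀ k) →ₗ[k] Sha k X :=
  Finsupp.lmapDomain k k (Sigma.mk h)

@[simp]
theorem headIncl_single {h : Bool} (p : Word X h) (c : k) :
    headIncl k h (Finsupp.single p c) = Finsupp.single ⟨h, p⟩ c := by
  simp [headIncl]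

theorem shaOps_mul_single {h h' : Bool} (p : Word X h) (q : Word X h') :
    (shaOps e wt).mul (Finsupp.single ⟨h, p⟩ 1) (Finsupp.single ⟨h', q⟩ 1) =
      headIncl k h (mulWord e wt p q) := by
  simp [shaOps, headIncl]

theorem shaOps_mul_headIncl {h h' : Bool} (a : Word X h →₀ k) (b : Word X h' →₀ k) :
    (shaOps e wt).mul (headIncl k h a) (headIncl k h' b) =
      headIncl k h (mulLin e wt h h' a b) := by
  induction a using finsupp_induction with
  | zero => simp
  | add f g hf hg => simp only [map_add, LinearMap.add_apply, hf, hg]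
  | smul c f hf => simp only [map_smul, LinearMap.smul_apply, hf]
  | single p =>
  induction b using finsupp_induction with
  | zero => simp
  | add f g hf hg => simp only [map_add, hf, hg]
  | smul c f hf => simp only [map_smul, hf]
  | single q => simp only [headIncl_single, shaOps_mul_single, mulLin_single]

@[simp]
theorem shaOps_R_single {h : Bool} (p : Word X h) :
    (shaOps e wt).R (Finsupp.single ⟨h, p⟩ 1) = Finsupp.single ⟨true, Word.bracket p⟩ 1 := by
  simp [shaOps]

theorem shaOps_R_headIncl {h : Bool} (a : Word X h →₀ k) :
    (shaOps e wt).R (headIncl k h a) = headIncl k true (bracketLin k h a) := by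
  induction a using finsupp_induction with
  | zero => simp
  | add f g hf hg => simp only [map_add, hf, hg]
  | smul c f hf => simp only [map_smul, hf]
  | single p => simp

@[simp]
theorem shaIncl_basis (x : X) :
    shaIncl e (e x) = Finsupp.single ⟨false, Word.letter x⟩ 1 := by
  simp [shaIncl]

theorem shaIncl_eq (a : B) : shaIncl e a = headIncl k false (letterLin e a) := by
  induction a using basis_induction e with
  | zero => simp
  | add f g hf hg => simp only [map_add, hf, hg]
  | smul c f hf => simp only [map_smul, hf]
  | basis p => simp

theorem single_letterCons (x : X) (z : Word X true) :
    (Finsupp.single ⟨false, Word.letterCons x z⟩ 1 : Sha k X) =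
      (shaOps e wt).mul (shaIncl e (e x)) (Finsupp.single ⟨true, z⟩ 1) := by
  cases z <;> simp [shaOps_mul_single, mulWord]

theorem single_bracketCons {h : Bool} (u : Word X h) (z : Word X false) :
    (Finsupp.single ⟨true, Word.bracketCons u z⟩ 1 : Sha k X) =
      (shaOps e wt).mul ((shaOps e wt).R (Finsupp.single ⟨h, u⟩ 1))
        (Finsupp.single ⟨false, z⟩ 1) := by
  cases z <;> simp [shaOps_mul_single, mulWord]

section Lift

variable {A' : Type*} [AddCommGroup A'] [Module k A'] (o' : RBOps k A') (f : B →ₗ[k] A')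

/-- The value on a word of the Rota-Baxter morphism extending `f`. -/
def liftWord : {h : Bool} → Word X h → A'
  | _, .letter x => f (e x)
  | _, .bracket u => o'.R (liftWord u)
  | _, .letterCons x z => o'.mul (f (e x)) (liftWord z)
  | _, .bracketCons u z => o'.mul (o'.R (liftWord u)) (liftWord z)

/-- The Rota-Baxter morphism extending `f`. -/
def shaLift : Sha k X →ₗ[k] A' :=
  Finsupp.linearCombination k fun p : RBWord X => liftWord e o' f p.2

@[simp]
theorem shaLift_single {h : Bool} (p : Word X h) :
    shaLift e o' f (Finsupp.single ⟨h, p⟩ 1) = liftWord e o' f p := by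
  simp [shaLift]

theorem shaLift_R (a : Sha k X) :
    shaLift e o' f ((shaOps e wt).R a) = o'.R (shaLift e o' f a) := by
  induction a using finsupp_induction with
  | zero => simp
  | add f g hf hg => simp only [map_add, hf, hg]
  | smul c f hf => simp only [map_smul, hf]
  | single p =>
    obtain ⟨h, p⟩ := p
    simp [liftWord]

theorem shaLift_shaIncl (a : B) : shaLift e o' f (shaIncl e a) = f a := by
  induction a using basis_induction e with
  | zero => simp
  | add f g hf hg => simp only [map_add, hf, hg]
  | smul c f hf => simp only [map_smul, hf]
  | basis p => simp [liftWord]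

theorem shaLift_letterLin (a : B) :
    shaLift e o' f (headIncl k false (letterLin e a)) = f a := by
  rw [← shaIncl_eq, shaLift_shaIncl]

theorem shaLift_bracketLin {h : Bool} (u : Word X h →₀ k) :
    shaLift e o' f (headIncl k true (bracketLin k h u)) =
      o'.R (shaLift e o' f (headIncl k h u)) := by
  -- The weight 1 is an arbitrary choice: the operator `R` does not depend on it.
  rw [← shaOps_R_headIncl e 1, shaLift_R]

theorem shaLift_letterConsLin (a : B) (z : Word X true →₀ k) :
    shaLift e o' f (headIncl k false (letterConsLin e a z)) =
      o'.mul (f a) (shaLift e o' f (headIncl k true z)) := by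
  induction a using basis_induction e with
  | zero => simp
  | add f g hf hg => simp only [map_add, LinearMap.add_apply, hf, hg]
  | smul c f hf => simp only [map_smul, LinearMap.smul_apply, hf]
  | basis x =>
  induction z using finsupp_induction with
  | zero => simp
  | add f g hf hg => simp only [map_add, hf, hg]
  | smul c f hf => simp only [map_smul, hf]
  | single z => simp [liftWord]

theorem shaLift_bracketConsLin {h : Bool} (u : Word X h →₀ k) (z : Word X false →₀ k) :
    shaLift e o' f (headIncl k true (bracketConsLin k h u z)) =
      o'.mul (o'.R (shaLift e o' f (headIncl k h u))) (shaLift e o' f (headIncl k false z)) := by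
  induction u using finsupp_induction with
  | zero => simp
  | add f g hf hg => simp only [map_add, LinearMap.add_apply, hf, hg]
  | smul c f hf => simp only [map_smul, LinearMap.smul_apply, hf]
  | single u =>
  induction z using finsupp_induction with
  | zero => simp
  | add f g hf hg => simp only [map_add, hf, hg]
  | smul c f hf => simp only [map_smul, hf]
  | single z => simp [liftWord]

/-- Each constructor of words is a product or a bracket in the algebra itself, so the one-letter
words generate everything under `⋄` and `R`. -/
theorem shaOps_hom_ext (g g' : Sha k X →ₗ[k] A') (hg : (shaOps e wt).IsHom o' g)
    (hg' : (shaOps e wt).IsHom o' g') (h : g ∘ₗ shaIncl e = g' ∘ₗ shaIncl e) : g = g' := by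
  have key : ∀ {h : Bool} (p : Word X h),
      g (Finsupp.single ⟨h, p⟩ 1) = g' (Finsupp.single ⟨h, p⟩ 1) := by
    intro h' p
    induction p with
    | letter x => simpa using LinearMap.congr_fun h (e x)
    | bracket u ih => rw [← shaOps_R_single e wt, hg.map_R, hg'.map_R, ih]
    | letterCons x z ih =>
      rw [single_letterCons e wt, hg.map_mul, hg'.map_mul, ih]
      exact congrArg (fun a => o'.mul a _) (LinearMap.congr_fun h (e x))
    | bracketCons u z ihu ihz =>
      rw [single_bracketCons e wt, hg.map_mul, hg'.map_mul, hg.map_R, hg'.map_R, ihu, ihz]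
  ext ⟨h', p⟩
  exact key p

end Lift

variable [IsScalarTower k B B] [SMulCommClass k B B]

theorem shaOps_isRotaBaxter : (shaOps e wt).IsRotaBaxter wt where
  assoc x y z := by
    induction x using finsupp_induction with
    | zero => simp
    | add f g hf hg => simp only [map_add, LinearMap.add_apply, hf, hg]
    | smul c f hf => simp only [map_smul, LinearMap.smul_apply, hf]
    | single p =>
    induction y using finsupp_induction with
    | zero => simp
    | add f g hf hg => simp only [map_add, LinearMap.add_apply, hf, hg]
    | smul c f hf => simp only [map_smul, LinearMap.smul_apply, hf]
    | single q =>
    induction z using finsupp_induction with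
    | zero => simp
    | add f g hf hg => simp only [map_add, hf, hg]
    | smul c f hf => simp only [map_smul, hf]
    | single r =>
    obtain ⟨h, p⟩ := p
    obtain ⟨h', q⟩ := q
    obtain ⟨h'', r⟩ := r
    simp only [← headIncl_single, shaOps_mul_headIncl,
      mulLin_assoc_single e wt _ p q r le_rfl]
  rota_baxter x y := by
    induction x using finsupp_induction with
    | zero => simp
    | add f g hf hg => simp only [map_add, LinearMap.add_apply, hf, hg, smul_add]; module
    | smul c f hf =>
      simp only [map_smul, LinearMap.smul_apply, hf, map_add]; module
    | single p =>
    induction y using finsupp_induction with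
    | zero => simp
    | add f g hf hg => simp only [map_add, hf, hg, smul_add]; module
    | smul c f hf => simp only [map_smul, hf, map_add]; module
    | single q =>
    obtain ⟨h, p⟩ := p
    obtain ⟨h', q⟩ := q
    simp only [← headIncl_single, shaOps_mul_headIncl, shaOps_R_headIncl, map_add, map_smul,
      mulLin_bracket_bracket]

theorem shaIncl_isAlgHom : (shaOps e wt).IsAlgHom (shaIncl e) := by
  intro x y
  simp only [shaIncl_eq, shaOps_mul_headIncl, mulLin_letter_letter]

variable {A' : Type*} [AddCommGroup A'] [Module k A'] (o' : RBOps k A') (f : B →ₗ[k] A')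

-- The cases follow the definition of `⋄`: letters meeting use that f is multiplicative, brackets
-- meeting use the Rota-Baxter identity of the target together with the three smaller products, and
-- the rest is associativity of the target.
open Word Finsupp in
theorem shaLift_mulLin_single (ho' : o'.IsRotaBaxter wt) (hf : o'.IsAlgHom f) (n : ℕ) :
    ∀ {h h' : Bool} (p : Word X h) (q : Word X h'), p.size + q.size ≤ n →
    shaLift e o' f (headIncl k h (mulLin e wt h h' (single p 1) (single q 1))) =
      o'.mul (liftWord e o' f p) (liftWord e o' f q) := by
  induction n with
  | zero =>
    intro h h' p q hn
    cases p <;> simp [Word.size] at hn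
  | succ n ih =>
    intro h h' p q hn
    rcases p with x | u | ⟨x, z⟩ | ⟨u, z⟩
    · rw [← letterLin_basis e]
      rcases q with y | v | ⟨y, z⟩ | ⟨v, z⟩
      · rw [← letterLin_basis e, mulLin_letter_letter, shaLift_letterLin]
        exact hf _ _
      · rw [mulLin_letter_true, shaLift_letterConsLin, headIncl_single, shaLift_single]
        rfl
      · rw [← letterConsLin_basis e, mulLin_letter_letterCons, shaLift_letterConsLin,
          headIncl_single, shaLift_single, hf, ho'.assoc]
        rfl
      · rw [mulLin_letter_true, shaLift_letterConsLin, headIncl_single, shaLift_single]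
        rfl
    · simp only [size] at hn
      rw [← bracketLin_single]
      rcases q with y | v | ⟨y, z⟩ | ⟨v, z⟩
      · rw [mulLin_bracket_false, shaLift_bracketConsLin]
        simp only [headIncl_single, shaLift_single, liftWord]
      · simp only [size] at hn
        have h1 := ih (bracket u) v (by simp only [size]; omega)
        have h2 := ih u (bracket v) (by simp only [size]; omega)
        have h3 := ih u v (by omega)
        simp only [← bracketLin_single] at h1 h2 ⊢
        simp only [mulLin_bracket_bracket, map_add, map_smul, shaLift_bracketLin, h1, h2, h3,
          liftWord, ho'.rota_baxter]
      · rw [mulLin_bracket_false, shaLift_bracketConsLin]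
        simp only [headIncl_single, shaLift_single, liftWord]
      · simp only [size] at hn
        have h1 := ih (bracket u) v (by simp only [size]; omega)
        have h2 := ih u (bracket v) (by simp only [size]; omega)
        have h3 := ih u v (by omega)
        simp only [← bracketLin_single, ← bracketConsLin_single] at h1 h2 ⊢
        simp only [mulLin_bracket_bracketCons, map_add, map_smul, shaLift_bracketConsLin, h1, h2,
          h3, liftWord, ← ho'.assoc, ho'.rota_baxter, LinearMap.add_apply, LinearMap.smul_apply,
          headIncl_single, shaLift_single]
    · simp only [size] at hn
      rw [← letterConsLin_basis e, mulLin_letterCons, shaLift_letterConsLin,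
        ih z q (by omega), ← ho'.assoc]
      rfl
    · simp only [size] at hn
      rw [← bracketConsLin_single, mulLin_bracketCons, shaLift_bracketConsLin,
        ih z q (by omega), ← ho'.assoc, headIncl_single, shaLift_single]
      rfl

theorem shaLift_isHom (ho' : o'.IsRotaBaxter wt) (hf : o'.IsAlgHom f) :
    (shaOps e wt).IsHom o' (shaLift e o' f) where
  map_mul := by
    refine map_bilinear_of_single ?_
    rintro ⟨h, p⟩ ⟨h', q⟩
    rw [shaOps_mul_single, ← mulLin_single, shaLift_mulLin_single e wt o' f ho' hf _ p q le_rfl,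
      shaLift_single, shaLift_single]
  map_R := shaLift_R e wt o' f

theorem shaOps_isFree : RBOps.IsFree.{w} (shaOps e wt) wt (shaIncl e) := by
  refine ⟨shaOps_isRotaBaxter e wt, shaIncl_isAlgHom e wt, ?_⟩
  intro A' _ _ o' ho' f hf
  have hc : shaLift e o' f ∘ₗ shaIncl e = f := LinearMap.ext (shaLift_shaIncl e o' f)
  refine ⟨shaLift e o' f, ⟨shaLift_isHom e wt o' f ho' hf, hc⟩, ?_⟩
  rintro g ⟨hg, hgf⟩
  exact shaOps_hom_ext e wt o' g _ hg (shaLift_isHom e wt o' f ho' hf) (hgf.trans hc.symm)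

end ShaFree

/-- The Rota-Baxter identity says R(x ⋆ y) = R(x)R(y), which turns the two axioms containing `⋆`
into associativity; the other five are associativity alone, up to scalars. -/
theorem RBOps.IsRotaBaxter.toTri_isDendriform {k : Type*} [Field k] {A : Type*} [AddCommGroup A]
    [Module k A] {o : RBOps k A} {wt : k} (ho : o.IsRotaBaxter wt) :
    (o.toTri wt).IsDendriform := by
  constructor <;> intro x y z <;>
    simp only [RBOps.toTri, TriOps.star, LinearMap.add_apply, LinearMap.compl₂_apply,
      LinearMap.comp_apply, LinearMap.smul_apply, map_smul, ho.assoc, ho.rota_baxter]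
  · rw [add_comm (o.mul (o.R y) z)]
  · rw [← ho.assoc, ho.rota_baxter, add_comm (o.mul x (o.R y))]


-- Decorated trees and their lifts to trialgebras

section DTFree

variable {k : Type*} [Field k] {Ω : Type*}

theorem dtOps_prec_single (t s : Node Ω) :
    (dtOps k Ω).prec (Finsupp.single t 1) (Finsupp.single s 1) =
      (starTree k t.last (.node s)).mapDomain fun S => t.setLast S := by
  simp [dtOps]

theorem dtOps_succ_single (t s : Node Ω) :
    (dtOps k Ω).succ (Finsupp.single t 1) (Finsupp.single s 1) =
      (starTree k (.node t) s.first).mapDomain fun S => s.setFirst S := by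
  simp [dtOps]

theorem dtOps_dot_single (t s : Node Ω) :
    (dtOps k Ω).dot (Finsupp.single t 1) (Finsupp.single s 1) =
      (starTree k t.last s.first).mapDomain fun S => Node.fuse S s t := by
  simp [dtOps]

@[simp]
theorem starTree_leaf_left (U : Tree Ω) : starTree k .leaf U = Finsupp.single U 1 := by
  cases U <;> simp [starTree]

@[simp]
theorem starTree_leaf_right (T : Tree Ω) : starTree k T .leaf = Finsupp.single T 1 := by
  cases T <;> simp [starTree]

@[simp]
theorem Node.setFirst_first (t : Node Ω) : t.setFirst t.first = t := by
  cases t <;> rfl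

@[simp]
theorem Node.setLast_last : (t : Node Ω) → t.setLast t.last = t
  | .two _ _ _ => rfl
  | .cons _ _ t => congrArg _ (Node.setLast_last t)

@[simp]
theorem dtIncl_basis {V : Type*} [AddCommGroup V] [Module k V] (b : Basis Ω k V) (x : Ω) :
    dtIncl b (b x) = Finsupp.single (Node.two .leaf x .leaf) 1 := by
  simp [dtIncl]

variable {E : Type*} [AddCommGroup E] [Module k E] (o : TriOps k E) (f : Ω → E)

mutual
/-- The value on a tree other than `|` of the trialgebra morphism sending `| ∨_x |` to `f x`. -/
def liftNode : Node Ω → E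
  | .two l x r => precTree r (succTree l (f x))
  | .cons l x t => o.dot (succTree l (f x)) (liftNode t)
/-- Left multiplication `≻` by the value of a tree; the identity for `|`. -/
def succTree : Tree Ω → E →ₗ[k] E
  | .leaf => LinearMap.id
  | .node t => o.succ (liftNode t)
/-- Right multiplication `≺` by the value of a tree; the identity for `|`. -/
def precTree : Tree Ω → E →ₗ[k] E
  | .leaf => LinearMap.id
  | .node t => o.prec.flip (liftNode t)
end

/-- The trialgebra morphism sending `| ∨_x |` to `f x`. -/
def dtLift : DT k Ω →ₗ[k] E := Finsupp.linearCombination k (liftNode o f)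

/-- The linear extension of `succTree`. -/
def succTreeLin : (Tree Ω →₀ k) →ₗ[k] E →ₗ[k] E := Finsupp.linearCombination k (succTree o f)

/-- The linear extension of `precTree`. -/
def precTreeLin : (Tree Ω →₀ k) →ₗ[k] E →ₗ[k] E := Finsupp.linearCombination k (precTree o f)

@[simp]
theorem dtLift_single (t : Node Ω) : dtLift o f (Finsupp.single t 1) = liftNode o f t := by
  simp [dtLift]

@[simp]
theorem succTreeLin_single (T : Tree Ω) :
    succTreeLin o f (Finsupp.single T (1 : k)) = succTree o f T := by
  simp [succTreeLin]

@[simp]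
theorem precTreeLin_single (T : Tree Ω) :
    precTreeLin o f (Finsupp.single T (1 : k)) = precTree o f T := by
  simp [precTreeLin]

theorem succTreeLin_mapDomain_node (m : DT k Ω) :
    succTreeLin o f (m.mapDomain Tree.node) = o.succ (dtLift o f m) := by
  induction m using finsupp_induction with
  | zero => simp
  | add f g hf hg => simp only [Finsupp.mapDomain_add, map_add, hf, hg]
  | smul c f hf => simp only [Finsupp.mapDomain_smul, map_smul, hf]
  | single t => simp [succTree]

theorem precTreeLin_mapDomain_node (m : DT k Ω) :
    precTreeLin o f (m.mapDomain Tree.node) = o.prec.flip (dtLift o f m) := by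
  induction m using finsupp_induction with
  | zero => simp
  | add f g hf hg => simp only [Finsupp.mapDomain_add, map_add, hf, hg]
  | smul c f hf => simp only [Finsupp.mapDomain_smul, map_smul, hf]
  | single t => simp [precTree]

theorem starTree_node_node (t s : Node Ω) :
    starTree k (.node t) (.node s) =
      ((dtOps k Ω).star (Finsupp.single t 1) (Finsupp.single s 1)).mapDomain Tree.node := by
  rw [starTree]
  simp only [TriOps.star, LinearMap.add_apply, dtOps_prec_single, dtOps_succ_single,
    dtOps_dot_single, Finsupp.mapDomain_add, ← Finsupp.mapDomain_comp]
  rfl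

variable {o}

/-- Left `≻` operators commute with right `≺` operators: this is the axiom `succ_prec`, trivial when
a tree is |. -/
theorem precTree_succTree (ho : o.IsDendriform) (S T : Tree Ω) (a : E) :
    precTree o f S (succTree o f T a) = succTree o f T (precTree o f S a) := by
  cases S <;> cases T <;> simp [precTree, succTree, ho.succ_prec]

/-- The first branch enters the value of a tree only as an outermost left `≻` operator, which
`succ_prec` and `succ_dot` allow to be pulled out. The next two lemmas treat the last branch and a
shared middle branch likewise. -/
theorem liftNode_setFirst (ho : o.IsDendriform) (S : Tree Ω) (s : Node Ω) :
    liftNode o f (s.setFirst S) = succTree o f S (liftNode o f (s.setFirst .leaf)) := by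
  cases s with
  | two l x r => simp [Node.setFirst, liftNode, precTree_succTree f ho, succTree]
  | cons l x t => cases S <;> simp [Node.setFirst, liftNode, succTree, ho.succ_dot]

theorem liftNode_setLast (ho : o.IsDendriform) (S : Tree Ω) : (t : Node Ω) →
    liftNode o f (t.setLast S) = precTree o f S (liftNode o f (t.setLast .leaf))
  | .two l x r => by simp [Node.setLast, liftNode, precTree]
  | .cons l x t => by
    rw [Node.setLast, Node.setLast, liftNode, liftNode, liftNode_setLast ho S t]
    cases S <;> simp [precTree, ho.dot_prec]

theorem liftNode_fuse (ho : o.IsDendriform) (S : Tree Ω) (s : Node Ω) : (t : Node Ω) →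
    liftNode o f (Node.fuse S s t) =
      o.dot (liftNode o f (t.setLast S)) (liftNode o f (s.setFirst .leaf))
  | .two l x r => by
    rw [Node.fuse, Node.setLast, liftNode, liftNode, liftNode_setFirst f ho]
    cases S <;> simp [precTree, succTree, ho.prec_dot]
  | .cons l x t => by
    rw [Node.fuse, Node.setLast, liftNode, liftNode, liftNode_fuse ho S s t, ho.dot_dot]

theorem dtLift_mapDomain_setFirst (ho : o.IsDendriform) (m : Tree Ω →₀ k) (s : Node Ω) :
    dtLift o f (m.mapDomain fun S => s.setFirst S) =
      succTreeLin o f m (liftNode o f (s.setFirst .leaf)) := by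
  induction m using finsupp_induction with
  | zero => simp
  | add f g hf hg => simp only [Finsupp.mapDomain_add, map_add, hf, hg, LinearMap.add_apply]
  | smul c f hf => simp only [Finsupp.mapDomain_smul, map_smul, hf, LinearMap.smul_apply]
  | single S => simp [liftNode_setFirst f ho S]

theorem dtLift_mapDomain_setLast (ho : o.IsDendriform) (m : Tree Ω →₀ k) (t : Node Ω) :
    dtLift o f (m.mapDomain fun S => t.setLast S) =
      precTreeLin o f m (liftNode o f (t.setLast .leaf)) := by
  induction m using finsupp_induction with
  | zero => simp
  | add f g hf hg => simp only [Finsupp.mapDomain_add, map_add, hf, hg, LinearMap.add_apply]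
  | smul c f hf => simp only [Finsupp.mapDomain_smul, map_smul, hf, LinearMap.smul_apply]
  | single S => simp [liftNode_setLast f ho S]

theorem dtLift_mapDomain_fuse (ho : o.IsDendriform) (m : Tree Ω →₀ k) (t s : Node Ω) :
    dtLift o f (m.mapDomain fun S => Node.fuse S s t) =
      o.dot (precTreeLin o f m (liftNode o f (t.setLast .leaf)))
        (liftNode o f (s.setFirst .leaf)) := by
  induction m using finsupp_induction with
  | zero => simp
  | add f g hf hg => simp only [Finsupp.mapDomain_add, map_add, hf, hg, LinearMap.add_apply]
  | smul c f hf => simp only [Finsupp.mapDomain_smul, map_smul, hf, LinearMap.smul_apply]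
  | single S => simp [liftNode_fuse f ho S, liftNode_setLast f ho S t]

/-- The hypothesis is the instance of `treeLin_starTree` for the smaller pair of trees occurring in
the definition of t ≺ s. Keeping it as a hypothesis lets the lemma serve inside that induction and
after it; the same holds for `≻` and `·` below. -/
theorem dtLift_prec_single (ho : o.IsDendriform) {t s : Node Ω}
    (h : precTreeLin o f (starTree k t.last (.node s)) =
      precTree o f (.node s) ∘ₗ precTree o f t.last) :
    dtLift o f ((dtOps k Ω).prec (Finsupp.single t 1) (Finsupp.single s 1)) =
      o.prec (liftNode o f t) (liftNode o f s) := by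
  rw [dtOps_prec_single, dtLift_mapDomain_setLast f ho, h, LinearMap.comp_apply,
    ← liftNode_setLast f ho, Node.setLast_last]
  rfl

theorem dtLift_succ_single (ho : o.IsDendriform) {t s : Node Ω}
    (h : succTreeLin o f (starTree k (.node t) s.first) =
      succTree o f (.node t) ∘ₗ succTree o f s.first) :
    dtLift o f ((dtOps k Ω).succ (Finsupp.single t 1) (Finsupp.single s 1)) =
      o.succ (liftNode o f t) (liftNode o f s) := by
  rw [dtOps_succ_single, dtLift_mapDomain_setFirst f ho, h, LinearMap.comp_apply,
    ← liftNode_setFirst f ho, Node.setFirst_first]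
  rfl

theorem dot_precTree (ho : o.IsDendriform) (S : Tree Ω) (a b : E) :
    o.dot (precTree o f S a) b = o.dot a (succTree o f S b) := by
  cases S <;> simp [precTree, succTree, ho.prec_dot]

theorem dtLift_dot_single (ho : o.IsDendriform) {t s : Node Ω}
    (h : precTreeLin o f (starTree k t.last s.first) =
      precTree o f s.first ∘ₗ precTree o f t.last) :
    dtLift o f ((dtOps k Ω).dot (Finsupp.single t 1) (Finsupp.single s 1)) =
      o.dot (liftNode o f t) (liftNode o f s) := by
  rw [dtOps_dot_single, dtLift_mapDomain_fuse f ho, h, LinearMap.comp_apply,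
    ← liftNode_setLast f ho, Node.setLast_last, dot_precTree f ho, ← liftNode_setFirst f ho,
    Node.setFirst_first]

/-- For T and U both different from |, the smaller instances show that the lift respects T ⋆ U, and
then `star_succ` and `prec_prec` say precisely that `⋆` acts by composition. Both operators must be
carried together, since T ≻ U calls for the left one and T ≺ U, T · U for the right one. -/
theorem treeLin_starTree (ho : o.IsDendriform) (n : ℕ) : ∀ T U : Tree Ω, T.size + U.size ≤ n →
    succTreeLin o f (starTree k T U) = succTree o f T ∘ₗ succTree o f U ∧
      precTreeLin o f (starTree k T U) = precTree o f U ∘ₗ precTree o f T := by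
  induction n using Nat.strong_induction_on with
  | _ n ih =>
    rintro (_ | t) (_ | s) hn
    · simp [succTree, precTree]
    · simp [succTree, precTree]
    · simp [succTree, precTree]
    · have ht := t.size_last_lt
      have hs := s.size_first_lt
      simp only [Tree.size] at hn
      have key : dtLift o f ((dtOps k Ω).star (Finsupp.single t 1) (Finsupp.single s 1)) =
          o.star (liftNode o f t) (liftNode o f s) := by
        simp only [TriOps.star, LinearMap.add_apply, map_add]
        rw [dtLift_prec_single f ho
            (ih (t.last.size + s.size) (by omega) t.last (.node s) le_rfl).2,
          dtLift_succ_single f ho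
            (ih (t.size + s.first.size) (by omega) (.node t) s.first le_rfl).1,
          dtLift_dot_single f ho
            (ih (t.last.size + s.first.size) (by omega) t.last s.first le_rfl).2]
      rw [starTree_node_node, succTreeLin_mapDomain_node, precTreeLin_mapDomain_node, key]
      exact ⟨LinearMap.ext fun a => ho.star_succ _ _ a,
        LinearMap.ext fun a => (ho.prec_prec a _ _).symm⟩

theorem dtLift_isHom (ho : o.IsDendriform) : (dtOps k Ω).IsHom o (dtLift o f) := by
  have h := fun T U => treeLin_starTree f ho _ T U le_rfl
  refine ⟨map_bilinear_of_single fun t s => ?_, map_bilinear_of_single fun t s => ?_,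
    map_bilinear_of_single fun t s => ?_⟩
  · simpa only [dtLift_single] using dtLift_prec_single f ho (h t.last (.node s)).2
  · simpa only [dtLift_single] using dtLift_succ_single f ho (h (.node t) s.first).1
  · simpa only [dtLift_single] using dtLift_dot_single f ho (h t.last s.first).2

theorem dtLift_comp_dtIncl {V : Type*} [AddCommGroup V] [Module k V] (b : Basis Ω k V)
    (f : V →ₗ[k] E) : dtLift o (fun x => f (b x)) ∘ₗ dtIncl b = f :=
  b.ext fun x => by simp [liftNode, precTree, succTree]

/-- A morphism of trialgebras out of decorated trees is determined by the images of the trees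
`| ∨_x |`. -/
theorem eq_dtLift {g : DT k Ω →ₗ[k] E} (hg : (dtOps k Ω).IsHom o g)
    (h : ∀ x, g (Finsupp.single (Node.two .leaf x .leaf) 1) = f x) : g = dtLift o f := by
  -- Here T₀ ∨_x | = T₀ ≻ (| ∨_x |) when T₀ is not |.
  have hsucc (l : Tree Ω) (x : Ω) (hl : ∀ t, l = .node t →
      g (Finsupp.single t 1) = liftNode o f t) :
      g (Finsupp.single (Node.two l x .leaf) 1) = succTree o f l (f x) := by
    cases l with
    | leaf => exact h x
    | node t =>
      have := hg.map_succ (Finsupp.single t 1) (Finsupp.single (Node.two .leaf x .leaf) 1)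
      rw [h, hl t rfl, dtOps_succ_single] at this
      simpa [Node.first, Node.setFirst, succTree] using this
  have key (n : ℕ) : ∀ t : Node Ω, t.size ≤ n → g (Finsupp.single t 1) = liftNode o f t := by
    induction n using Nat.strong_induction_on with
    | _ n ih =>
      rintro (⟨l, x, r⟩ | ⟨l, x, t⟩) hn
      · simp only [Node.size] at hn
        have hl := hsucc l x fun t ht => ih t.size (by simp [ht, Tree.size] at hn; omega) t le_rfl
        cases r with
        | leaf => simpa [liftNode, precTree] using hl
        | node r =>
          -- The last branch | is neutral for `⋆`, so (l ∨_x |) ≺ r is the single tree l ∨_x r.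
          have := hg.map_prec (Finsupp.single (Node.two l x .leaf) 1) (Finsupp.single r 1)
          rw [hl, ih r.size (by simp [Tree.size] at hn; omega) r le_rfl, dtOps_prec_single] at this
          simpa [Node.last, Node.setLast, liftNode, precTree] using this
      · simp only [Node.size] at hn
        have hl := hsucc l x fun t ht => ih t.size (by simp [ht, Tree.size] at hn; omega) t le_rfl
        -- Likewise (l ∨_x |) · t is the single tree in which l and x are put in front of the root
        -- of t.
        have := hg.map_dot (Finsupp.single (Node.two l x .leaf) 1) (Finsupp.single t 1)
        rw [hl, ih t.size (by omega) t le_rfl, dtOps_dot_single] at this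
        simpa [Node.last, Node.fuse, liftNode] using this
  ext t
  simpa using key _ t le_rfl

theorem TriOps.IsDendriform.of_injective {D : Type*} [AddCommGroup D] [Module k D]
    {o' : TriOps k D} (ho : o.IsDendriform) {g : D →ₗ[k] E} (hg : o'.IsHom o g)
    (inj : Function.Injective g) : o'.IsDendriform := by
  have hstar (x y : D) : g (o'.star x y) = o.star (g x) (g y) := by
    simp [TriOps.star, hg.map_prec, hg.map_succ, hg.map_dot]
  constructor <;> intro x y z <;> apply inj <;>
    simp only [hg.map_prec, hg.map_succ, hg.map_dot, hstar]
  exacts [ho.prec_prec _ _ _, ho.succ_prec _ _ _, ho.star_succ _ _ _, ho.succ_dot _ _ _,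
    ho.prec_dot _ _ _, ho.dot_prec _ _ _, ho.dot_dot _ _ _]

theorem dtOps_isFree {V : Type*} [AddCommGroup V] [Module k V] (b : Basis Ω k V)
    (h : (dtOps k Ω).IsDendriform) : TriOps.IsFree.{w} (dtOps k Ω) (dtIncl b) := by
  refine ⟨h, fun E _ _ o ho f => ⟨dtLift o fun x => f (b x),
    ⟨dtLift_isHom _ ho, dtLift_comp_dtIncl b f⟩, ?_⟩⟩
  rintro g ⟨hg, hgf⟩
  exact eq_dtLift _ hg fun x => by simpa using LinearMap.congr_fun hgf (b x)

end DTFree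


-- Trees and dendriform triwords

section Triwords

open Word

variable {Ω : Type*}

theorem freeSemigroup_of_inj {x x' : Ω} : FreeSemigroup.of x = FreeSemigroup.of x' ↔ x = x' :=
  ⟨fun h => congrArg FreeSemigroup.head h, fun h => congrArg _ h⟩

theorem freeSemigroup_of_mul_inj {x x' : Ω} {y y' : FreeSemigroup Ω} :
    FreeSemigroup.of x * y = FreeSemigroup.of x' * y' ↔ x = x' ∧ y = y' := by
  constructor
  · intro h
    have h1 := congrArg FreeSemigroup.head h
    have h2 := congrArg FreeSemigroup.tail h
    simp only [FreeSemigroup.head_mul, FreeSemigroup.tail_mul, FreeSemigroup.of] at h1 h2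
    simp only [List.nil_append, List.cons.injEq] at h2
    exact ⟨h1, FreeSemigroup.ext h2.1 h2.2⟩
  · rintro ⟨rfl, rfl⟩
    rfl

theorem freeSemigroup_of_mul_ne_of {x x' : Ω} {y : FreeSemigroup Ω} :
    FreeSemigroup.of x * y ≠ FreeSemigroup.of x' := by
  intro h
  have h2 := congrArg FreeSemigroup.tail h
  simp [FreeSemigroup.of] at h2

/-- The first letter of the result has length one exactly when the original word starts with a
bracket, so the two ways of prepending cannot be confused. -/
theorem prepend_injective {x x' : Ω} : {p p' : RBWord (FreeSemigroup Ω)} →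
    prepend x p.2 = prepend x' p'.2 → x = x' ∧ p = p' := by
  rintro ⟨h, p⟩ ⟨h', p'⟩ e
  cases p <;> cases p' <;>
    simp_all [prepend, freeSemigroup_of_mul_inj, freeSemigroup_of_mul_ne_of,
      freeSemigroup_of_mul_ne_of.symm, freeSemigroup_of_inj]

theorem appendBracket_injective {X : Type*} {x x' : X} : {r r' : Option (RBWord X)} →
    appendBracket x r = appendBracket x' r' → x = x' ∧ r = r'
  | none, none, h => by simpa [appendBracket] using h
  | none, some _, h => by simp [appendBracket] at h
  | some _, none, h => by simp [appendBracket] at h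
  | some ⟨h1, u⟩, some ⟨h2, u'⟩, h => by
    simp only [appendBracket, letterCons.injEq, bracket.injEq] at h
    obtain ⟨rfl, rfl, h⟩ := h
    simp_all

theorem prependBracket_injective {X : Type*} {z z' : Word X false} :
    {l l' : Option (RBWord X)} →
    prependBracket l z = prependBracket l' z' → l = l' ∧ z = z'
  | none, none, h => by simpa [prependBracket] using h
  | none, some _, h => by simp [prependBracket] at h
  | some _, none, h => by simp [prependBracket] at h
  | some ⟨h1, u⟩, some ⟨h2, u'⟩, h => by
    simp only [prependBracket, Sigma.mk.injEq, true_and, heq_eq_eq, bracketCons.injEq] at h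
    obtain ⟨rfl, h, rfl⟩ := h
    simp_all

/-- This separates a root with two branches from a root with more. The hypothesis is essential: for
z = ⌊u⌋ both sides can be x⌊u⌋. -/
theorem appendBracket_ne_prepend {x x' : Ω} {r : Option (RBWord (FreeSemigroup Ω))} {h : Bool}
    {z : Word (FreeSemigroup Ω) h} (hz : ¬ z.IsBracket) :
    appendBracket (FreeSemigroup.of x) r ≠ prepend x' z := by
  intro e
  cases r <;> cases z <;>
    simp_all [appendBracket, prepend, freeSemigroup_of_mul_ne_of.symm, IsBracket]

theorem not_isBracket_of_false {X : Type*} : (z : Word X false) → ¬ z.IsBracket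
  | letter _ => id
  | letterCons _ _ => id

theorem noDouble_prepend (x : Ω) {h : Bool} {z : Word (FreeSemigroup Ω) h} (hz : z.NoDouble) :
    (prepend x z).NoDouble := by
  cases z <;> exact hz

theorem noDouble_appendBracket {X : Type*} (x : X) : {r : Option (RBWord X)} →
    (∀ p ∈ r, p.2.IsTriword) → (appendBracket x r).NoDouble
  | none, _ => trivial
  | some p, h => h p rfl

theorem isTriword_prependBracket {X : Type*} {z : Word X false} (hz : z.NoDouble) :
    {l : Option (RBWord X)} → (∀ p ∈ l, p.2.IsTriword) → (prependBracket l z).2.IsTriword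
  | none, _ => ⟨not_isBracket_of_false z, hz⟩
  | some p, h => ⟨id, (h p rfl).1, (h p rfl).2, hz⟩

mutual
theorem isTriword_psiNode : (t : Node Ω) → (psiNode t).2.IsTriword
  | .two l x r => by
    rw [psiNode]
    exact isTriword_prependBracket (noDouble_appendBracket _ (isTriword_psiTree r))
      (isTriword_psiTree l)
  | .cons l x t => by
    rw [psiNode]
    exact isTriword_prependBracket (noDouble_prepend x (isTriword_psiNode t).2)
      (isTriword_psiTree l)
theorem isTriword_psiTree : (T : Tree Ω) → ∀ p ∈ psiTree T, p.2.IsTriword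
  | .leaf => by simp [psiTree]
  | .node t => by
    rw [psiTree]
    rintro p ⟨⟩
    exact isTriword_psiNode t
end

mutual
theorem psiNode_injective : (t t' : Node Ω) → psiNode t = psiNode t' → t = t'
  | .two l x r, .two l' x' r', h => by
    rw [psiNode, psiNode] at h
    obtain ⟨h1, h2⟩ := prependBracket_injective h
    obtain ⟨h2, h3⟩ := appendBracket_injective h2
    rw [psiTree_injective l l' h1, psiTree_injective r r' h3, freeSemigroup_of_inj.1 h2]
  | .two l x r, .cons l' x' t', h => by
    rw [psiNode, psiNode] at h
    exact absurd (prependBracket_injective h).2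
      (appendBracket_ne_prepend (isTriword_psiNode t').1)
  | .cons l x t, .two l' x' r', h => by
    rw [psiNode, psiNode] at h
    exact absurd (prependBracket_injective h).2.symm
      (appendBracket_ne_prepend (isTriword_psiNode t).1)
  | .cons l x t, .cons l' x' t', h => by
    rw [psiNode, psiNode] at h
    obtain ⟨h1, h2⟩ := prependBracket_injective h
    obtain ⟨rfl, h3⟩ := prepend_injective h2
    rw [psiTree_injective l l' h1, psiNode_injective t t' h3]
theorem psiTree_injective : (T T' : Tree Ω) → psiTree T = psiTree T' → T = T'
  | .leaf, .leaf, _ => rfl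
  | .leaf, .node _, h => by simp [psiTree] at h
  | .node _, .leaf, h => by simp [psiTree] at h
  | .node t, .node t', h => by
    simp only [psiTree, Option.some.injEq] at h
    rw [psiNode_injective t t' h]
end

theorem psiNode_cons_leaf (x : Ω) {t : Node Ω} {h : Bool} {p : Word (FreeSemigroup Ω) h}
    (ht : psiNode t = ⟨h, p⟩) : psiNode (.cons .leaf x t) = ⟨false, prepend x p⟩ := by
  rw [psiNode, psiTree, ht]
  rfl

theorem exists_psiNode_letter (s : FreeSemigroup Ω) :
    ∃ t : Node Ω, psiNode t = ⟨false, letter s⟩ := by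
  induction s using FreeSemigroup.recOnMul with
  | ih1 x => exact ⟨.two .leaf x .leaf, by simp [psiNode, psiTree, prependBracket, appendBracket]⟩
  | ih2 x y _ ih =>
    obtain ⟨t, ht⟩ := ih
    exact ⟨.cons .leaf x t, psiNode_cons_leaf x ht⟩

theorem exists_psiNode_letterCons (s : FreeSemigroup Ω) {z : Word (FreeSemigroup Ω) true}
    (h : ∀ x, ∃ t : Node Ω, psiNode t = ⟨false, letterCons (FreeSemigroup.of x) z⟩) :
    ∃ t : Node Ω, psiNode t = ⟨false, letterCons s z⟩ := by
  induction s using FreeSemigroup.recOnMul with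
  | ih1 x => exact h x
  | ih2 x y _ ih =>
    obtain ⟨t, ht⟩ := ih
    exact ⟨.cons .leaf x t, psiNode_cons_leaf x ht⟩

/-- A tree whose word starts with a letter has first branch |; replacing that branch by t puts ⌊u⌋
in front. -/
theorem exists_psiNode_bracketCons {h : Bool} {u : Word (FreeSemigroup Ω) h}
    {z : Word (FreeSemigroup Ω) false} {t : Node Ω} (ht : psiNode t = ⟨h, u⟩) :
    (s : Node Ω) → psiNode s = ⟨false, z⟩ → ∃ s' : Node Ω, psiNode s' = ⟨true, bracketCons u z⟩
  | .two .leaf x r, hs => ⟨.two (.node t) x r, by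
      simp [psiNode, psiTree, prependBracket, ht] at hs ⊢; exact hs⟩
  | .cons .leaf x r, hs => ⟨.cons (.node t) x r, by
      simp [psiNode, psiTree, prependBracket, ht] at hs ⊢; exact hs⟩
  | .two (.node _) x r, hs => by simp [psiNode, psiTree, prependBracket] at hs
  | .cons (.node _) x r, hs => by simp [psiNode, psiTree, prependBracket] at hs

/-- The second conclusion makes the induction run: the tail of a triword may be a lone bracket ⌊u⌋,
which is no value of ψ, but x⌊u⌋ is one. -/
theorem exists_psiNode {h : Bool} (p : Word (FreeSemigroup Ω) h) :
    p.NoDouble → (¬ p.IsBracket → ∃ t, psiNode t = ⟨h, p⟩) ∧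
      ∀ x, ∃ t, psiNode t = ⟨false, prepend x p⟩ := by
  induction p with
  | letter s =>
    exact fun _ => ⟨fun _ => exists_psiNode_letter s,
      fun x => exists_psiNode_letter (FreeSemigroup.of x * s)⟩
  | bracket u ih =>
    intro hu
    obtain ⟨t, ht⟩ := (ih hu.2).1 hu.1
    refine ⟨fun h => (h trivial).elim, fun x => ⟨.two .leaf x (.node t), ?_⟩⟩
    rw [psiNode, psiTree, psiTree, ht]
    rfl
  | letterCons s z ih =>
    intro hz
    have h : ∀ x, ∃ t : Node Ω, psiNode t = ⟨false, letterCons (FreeSemigroup.of x) z⟩ := by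
      -- As z starts with a bracket, prepending x just adds a new letter.
      cases z <;> exact (ih hz).2
    exact ⟨fun _ => exists_psiNode_letterCons s h, fun x => exists_psiNode_letterCons _ h⟩
  | bracketCons u z ihu ihz =>
    intro h
    obtain ⟨t, ht⟩ := (ihu h.2.1).1 h.1
    obtain ⟨s, hs⟩ := (ihz h.2.2).1 (not_isBracket_of_false z)
    obtain ⟨r, hr⟩ := exists_psiNode_bracketCons ht s hs
    exact ⟨fun _ => ⟨r, hr⟩, fun x => ⟨.cons .leaf x r, psiNode_cons_leaf x hr⟩⟩

theorem range_psi (k : Type*) [Field k] :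
    LinearMap.range (psi k Ω) = triwordSpan k (FreeSemigroup Ω) := by
  apply le_antisymm
  · rintro _ ⟨a, rfl⟩
    induction a using finsupp_induction with
    | zero => simp
    | add f g hf hg => rw [map_add]; exact Submodule.add_mem _ hf hg
    | smul c f hf => rw [map_smul]; exact Submodule.smul_mem _ c hf
    | single t => exact Submodule.subset_span ⟨psiNode t, isTriword_psiNode t, by simp [psi]⟩
  · refine Submodule.span_le.2 ?_
    rintro _ ⟨⟨h, p⟩, hp, rfl⟩
    obtain ⟨t, ht⟩ := (exists_psiNode p hp.2).1 hp.1
    exact ⟨Finsupp.single t 1, by simp [psi, ht]⟩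

theorem psi_injective (k : Type*) [Field k] : Function.Injective (psi k Ω) :=
  Finsupp.mapDomain_injective fun t t' => psiNode_injective t t'

end Triwords

-- ψ as the universal morphism

section PsiHom

variable {k : Type*} [Field k] {V : Type*} [AddCommGroup V] [Module k V] {Ω : Type*}
variable (b : Basis Ω k V)

theorem tposBasis_apply (s : FreeSemigroup Ω) : tposBasis b s = pureTensor b s := by
  simp [tposBasis]

theorem tposBasis_mul (s t : FreeSemigroup Ω) :
    tposBasis b s * tposBasis b t = tposBasis b (s * t) := by
  simp only [tposBasis_apply, map_mul]

theorem tposBasis_of (x : Ω) : tposBasis b (FreeSemigroup.of x) = tposIncl k V (b x) := by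
  rw [tposBasis_apply]
  rfl

theorem shaOps_letter_mul_single (x : Ω) (p : RBWord (FreeSemigroup Ω)) :
    (shaOps (tposBasis b) 1).mul
        (Finsupp.single ⟨false, Word.letter (FreeSemigroup.of x)⟩ 1) (Finsupp.single p 1) =
      Finsupp.single ⟨false, prepend x p.2⟩ 1 := by
  obtain ⟨h, p⟩ := p
  cases p <;> simp [shaOps_mul_single, mulWord, prepend, tposBasis_mul]

theorem shaOps_letter_mul_bracket (x : Ω) (r : RBWord (FreeSemigroup Ω)) :
    (shaOps (tposBasis b) 1).mul
        (Finsupp.single ⟨false, Word.letter (FreeSemigroup.of x)⟩ 1)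
        ((shaOps (tposBasis b) 1).R (Finsupp.single r 1)) =
      Finsupp.single ⟨false, appendBracket (FreeSemigroup.of x) (some r)⟩ 1 := by
  obtain ⟨h, r⟩ := r
  rw [shaOps_R_single, shaOps_letter_mul_single]
  rfl

theorem shaOps_bracket_mul_single (l : RBWord (FreeSemigroup Ω))
    (z : Word (FreeSemigroup Ω) false) :
    (shaOps (tposBasis b) 1).mul ((shaOps (tposBasis b) 1).R (Finsupp.single l 1))
        (Finsupp.single ⟨false, z⟩ 1) =
      Finsupp.single (prependBracket (some l) z) 1 := by
  rw [← single_bracketCons]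
  rfl

theorem toTri_prec_apply {A : Type*} [AddCommGroup A] [Module k A] (o : RBOps k A) (wt : k)
    (x y : A) : (o.toTri wt).prec x y = o.mul x (o.R y) := rfl

theorem toTri_succ_apply {A : Type*} [AddCommGroup A] [Module k A] (o : RBOps k A) (wt : k)
    (x y : A) : (o.toTri wt).succ x y = o.mul (o.R x) y := rfl

theorem toTri_one_dot_apply {A : Type*} [AddCommGroup A] [Module k A] (o : RBOps k A)
    (x y : A) : (o.toTri 1).dot x y = o.mul x y := by
  simp [RBOps.toTri]

theorem succTree_dot {E : Type*} [AddCommGroup E] [Module k E] {o : TriOps k E}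
    (ho : o.IsDendriform) (f : Ω → E) (T : Tree Ω) (a c : E) :
    o.dot (succTree o f T a) c = succTree o f T (o.dot a c) := by
  cases T <;> simp [succTree, ho.succ_dot]

mutual
-- The first branch is moved to the outermost position before multiplying. Then every product met is
-- a letter times a word, or a bracket times a word starting with a letter, so a single word results
-- and the Rota-Baxter expansion never occurs.
theorem liftNode_eq_psiNode : (t : Node Ω) →
    liftNode ((shaOps (tposBasis b) 1).toTri 1)
        (fun x => Finsupp.single ⟨false, Word.letter (FreeSemigroup.of x)⟩ 1) t =
      Finsupp.single (psiNode t) (1 : k)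
  | .two l x .leaf => by
    simp only [liftNode, psiNode, precTree, psiTree, LinearMap.id_apply, appendBracket]
    exact succTree_eq_psiTree l _
  | .two l x (.node r) => by
    have ha := (shaOps_isRotaBaxter (tposBasis b) (1 : k)).toTri_isDendriform
    rw [liftNode, psiNode, precTree_succTree _ ha, precTree, LinearMap.flip_apply,
      liftNode_eq_psiNode r, toTri_prec_apply, shaOps_letter_mul_bracket, psiTree]
    exact succTree_eq_psiTree l _
  | .cons l x t => by
    have ha := (shaOps_isRotaBaxter (tposBasis b) (1 : k)).toTri_isDendriform
    rw [liftNode, psiNode, succTree_dot ha, liftNode_eq_psiNode t, toTri_one_dot_apply,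
      shaOps_letter_mul_single b]
    exact succTree_eq_psiTree l _
theorem succTree_eq_psiTree : (T : Tree Ω) → ∀ z : Word (FreeSemigroup Ω) false,
    succTree ((shaOps (tposBasis b) 1).toTri 1)
        (fun x => Finsupp.single ⟨false, Word.letter (FreeSemigroup.of x)⟩ 1) T
        (Finsupp.single ⟨false, z⟩ 1) =
      Finsupp.single (prependBracket (psiTree T) z) (1 : k)
  | .leaf, z => by rw [succTree, psiTree, LinearMap.id_apply, prependBracket]
  | .node t, z => by
    rw [succTree, liftNode_eq_psiNode t, toTri_succ_apply, shaOps_bracket_mul_single, psiTree]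
end

theorem psi_eq_dtLift : psi k Ω = dtLift ((shaOps (tposBasis b) 1).toTri 1)
    (fun x => Finsupp.single ⟨false, Word.letter (FreeSemigroup.of x)⟩ 1) := by
  ext1 t
  ext1
  simp [psi, liftNode_eq_psiNode]

theorem psi_isHom :
    (dtOps k Ω).IsHom ((shaOps (tposBasis b) 1).toTri 1) (psi k Ω) := by
  rw [psi_eq_dtLift b]
  exact dtLift_isHom _ (shaOps_isRotaBaxter (tposBasis b) 1).toTri_isDendriform

theorem shaIncl_tposIncl (x : Ω) :
    shaIncl (tposBasis b) (tposIncl k V (b x)) =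
      Finsupp.single ⟨false, Word.letter (FreeSemigroup.of x)⟩ 1 := by
  rw [← tposBasis_of, shaIncl_basis]

theorem psi_comp_dtIncl :
    psi k Ω ∘ₗ dtIncl b = shaIncl (tposBasis b) ∘ₗ tposIncl k V :=
  b.ext fun x => by
    simp [shaIncl_tposIncl, psi, psiNode, psiTree, prependBracket, appendBracket]

end PsiHom

end

end DendRB

-- The main theorem

theorem mainTheorem5 {k : Type*} [Field k] {V : Type*} [AddCommGroup V] [Module k V]
    {Ω : Type*} (b : Module.Basis Ω k V) :
    -- the trialgebra of decorated trees is the free dendriform trialgebra over `V`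
    DendRB.TriOps.IsFree.{w} (DendRB.dtOps k Ω) (DendRB.dtIncl b) ∧
    -- `Ш(T(V))` is the free Rota-Baxter algebra of weight one over `T(V)`
    DendRB.RBOps.IsFree.{w} (DendRB.shaOps (DendRB.tposBasis b) 1) 1
      (DendRB.shaIncl (DendRB.tposBasis b)) ∧
    -- and its operations `≺_R`, `≻_R`, `·_R` make it a dendriform trialgebra
    ((DendRB.shaOps (DendRB.tposBasis b) 1).toTri 1).IsDendriform ∧
    -- `ψ` is a morphism of dendriform trialgebras
    (DendRB.dtOps k Ω).IsHom ((DendRB.shaOps (DendRB.tposBasis b) 1).toTri 1)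
      (DendRB.psi k Ω) ∧
    -- `ψ` is the one induced by the natural map `V → T(V) → Ш(T(V))`
    DendRB.psi k Ω ∘ₗ DendRB.dtIncl b =
      DendRB.shaIncl (DendRB.tposBasis b) ∘ₗ DendRB.tposIncl k V ∧
    (∀ g : DendRB.DT k Ω →ₗ[k] DendRB.Sha k (FreeSemigroup Ω),
      (DendRB.dtOps k Ω).IsHom ((DendRB.shaOps (DendRB.tposBasis b) 1).toTri 1) g →
      g ∘ₗ DendRB.dtIncl b =
        DendRB.shaIncl (DendRB.tposBasis b) ∘ₗ DendRB.tposIncl k V →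
      g = DendRB.psi k Ω) ∧
    -- the image of `ψ` is the span of the dendriform triwords
    LinearMap.range (DendRB.psi k Ω) = DendRB.triwordSpan k (FreeSemigroup Ω) ∧
    -- `ψ` is injective
    Function.Injective (DendRB.psi k Ω) := by
  have hSha := DendRB.shaOps_isRotaBaxter (DendRB.tposBasis b) (1 : k)
  -- Not circular: that ψ preserves the operations was proved from the axioms of the target alone.
  have hDT := hSha.toTri_isDendriform.of_injective (DendRB.psi_isHom b) (DendRB.psi_injective k)
  refine ⟨DendRB.dtOps_isFree b hDT, DendRB.shaOps_isFree _ _, hSha.toTri_isDendriform,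
    DendRB.psi_isHom b, DendRB.psi_comp_dtIncl b, fun g hg hgb => ?_, DendRB.range_psi k,
    DendRB.psi_injective k⟩
  rw [DendRB.psi_eq_dtLift b]
  refine DendRB.eq_dtLift _ hg fun x => ?_
  rw [← DendRB.shaIncl_tposIncl b x, ← DendRB.dtIncl_basis b x]
  exact LinearMap.congr_fun hgb (b x)
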